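/- Setting. Let $n\ge 0$ and, for $j\in[n]$, let $(\Omega_j,\Sigma_j,\mu_j)$ be a $\sigma$-finite measure space and $\varphi_{0j},\varphi_{1j}$ two probability densities with respect to $\mu_j$ (probability mass functions if $\mu_j$ is a counting measure). On the product space $\Omega=\prod_j\Omega_j$ with $\mu=\bigotimes_j\mu_j$ put $\varphi_z(x)=\prod_{j}\varphi_{zj}(x_j)$, $z\in\{0,1\}$, and assume that both Kullback–Leibler divergences between the distributions with densities $\varphi_0$ and $\varphi_1$ are positive real numbers. For $\alpha\in(0,1)$ let $$C_\alpha(\varphi_0,\varphi_1)=-\log\int_\Omega\varphi_0^{1-\alpha}\varphi_1^{\alpha}\,d\mu,\qquad \varphi_\alpha=\varphi_0^{1-\alpha}\varphi_1^{\alpha}e^{C_\alpha(\varphi_0,\varphi_1)},$$ and define $\varphi_{\alpha j}$ in the same way from $\varphi_{0j},\varphi_{1j}$. Let $\alpha^*=\arg\max_{\alpha\in(0,1)}C_\alpha(\varphi_0,\varphi_1)$, let $Y=(Y_1,\dots,Y_n)\sim\varphi_{\alpha^*}$, so that the $Y_j\sim\varphi_{\alpha^*j}$ are independent, and put $$Z_j=\log\frac{\varphi_{0j}}{\varphi_{1j}}(Y_j)-\mathbb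 E\Big[\log\frac{\varphi_{0j}}{\varphi_{1j}}(Y_j)\Big],\qquad \bar\sigma_n=\Big(\frac1n\sum_{j=1}^n\mathrm{Var}[Z_j]\Big)^{1/2},$$ $$\eta(\varphi_0,\varphi_1)=\int_\Omega\min(\varphi_0,\varphi_1)\,d\mu,\qquad g_\alpha(x)=\exp\big[\min(\alpha x,(\alpha-1)x)\big].$$ Exponential families. For $j\in[n]$ consider an exponential family of densities $h_j(x)\exp[\theta^\top T_j(x)-A_j(\theta)]$ with respect to $\mu_j$, with parameter $\theta$ in a convex set $\Theta_j\subseteq\mathbb R^d$, $h_j\ge 0$, and log-partition function $A_j$ smooth on $\Theta_j$ (if $\Theta_j$ is not open: $A_j$ is given with an extension that is smooth at every point of $\Theta_j$). One family common to all $j$ is a special case. Statement. For every $C_1$ there are positive constants $C_2,C_3,C_4$ depending only on $C_1$ such that the following holds for all data as above. The maximizer $\alpha^*\in(0,1)$ exists and is unique, and $\bar\sigma_n>0$. (i) General densities. If $\sum_{j}\mathbb E|Z_j|^3\le C_1n\bar\sigma_n^2$, then $$\mathbb E\Big[g_{\alpha^*}\Big(\log\frac{\varphi_0}{\varphi_1}(Y)\Big)\Big]\le\frac{C_2}{\sqrt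 n\,\bar\sigma_n(1-\alpha^*)\alpha^*},\qquad \eta(\varphi_0,\varphi_1)\le\frac{C_2}{\sqrt n\,\bar\sigma_n(1-\alpha^*)\alpha^*}\,e^{-C_{\alpha^*}(\varphi_0,\varphi_1)},$$ and if moreover $\sqrt n\,\bar\sigma_n(1-\alpha^*)\alpha^*\ge C_3$, then both reverse inequalities hold with $C_4$ in place of $C_2$. (ii) Exponential families. Suppose that $\varphi_{zj}(x)=h_j(x)\exp[\theta_{zj}^\top T_j(x)-A_j(\theta_{zj})]$ with $\theta_{zj}\in\Theta_j$ for $z\in\{0,1\}$ and $j\in[n]$, and put $\theta_{\alpha j}=(1-\alpha)\theta_{0j}+\alpha\theta_{1j}$. Then $$\mathrm{Var}[Z_j]=(\theta_{0j}-\theta_{1j})^\top\mathrm{Hess}A_j(\theta_{\alpha^*j})(\theta_{0j}-\theta_{1j})\ \ (j\in[n]),\qquad \bar\sigma_n^2=\frac1n\sum_{j=1}^n(\theta_{0j}-\theta_{1j})^\top\mathrm{Hess}A_j(\theta_{\alpha^*j})(\theta_{0j}-\theta_{1j}),$$ $$C_{\alpha^*}(\varphi_0,\varphi_1)=\sum_{j=1}^n\big[(1-\alpha^*)A_j(\theta_{0j})+\alpha^*A_j(\theta_{1j})-A_j(\theta_{\alpha^*j})\big].$$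 If $\sum_{j}\mathbb E|Z_j|^3\le C_1n\bar\sigma_n^2$, then, with the same constants, $$\eta(\varphi_0,\varphi_1)\le\frac{C_2}{\sqrt n\,\bar\sigma_n(1-\alpha^*)\alpha^*}\exp\Big(-\sum_{j=1}^n\big[(1-\alpha^*)A_j(\theta_{0j})+\alpha^*A_j(\theta_{1j})-A_j(\theta_{\alpha^*j})\big]\Big),$$ and if moreover $\sqrt n\,\bar\sigma_n(1-\alpha^*)\alpha^*\ge C_3$, then $$\eta(\varphi_0,\varphi_1)\ge\frac{C_4}{\sqrt n\,\bar\sigma_n(1-\alpha^*)\alpha^*}\exp\Big(-\sum_{j=1}^n\big[(1-\alpha^*)A_j(\theta_{0j})+\alpha^*A_j(\theta_{1j})-A_j(\theta_{\alpha^*j})\big]\Big).$$ -/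

import Mathlib

open MeasureTheory ProbabilityTheory
open scoped ENNReal ContDiff

universe u

noncomputable section

/-- `f` is a probability density function with respect to `ν` (a probability mass function if `ν`
is a counting measure). -/
structure IsDensity {X : Type u} [MeasurableSpace X] (ν : Measure X) (f : X → ℝ) : Prop where
  measurable : Measurable f
  nonneg : ∀ x, 0 ≤ f x
  integral_eq_one : ∫ x, f x ∂ν = 1

/-- The probability measure with density `f` with respect to `ν`. -/
def densityMeasure {X : Type u} [MeasurableSpace X] (ν : Measure X) (f : X → ℝ) : Measure X :=
  ν.withDensity fun x => ENNReal.ofReal (f x)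

/-- The product density `φ(x₁, …, xₙ) = ∏ⱼ φⱼ(xⱼ)` on the product space. -/
def prodDensity {n : ℕ} {Ω : Fin n → Type u} (φ : ∀ j, Ω j → ℝ) (x : ∀ j, Ω j) : ℝ :=
  ∏ j, φ j (x j)

/-- The class of pairs of product densities whose two Kullback-Leibler divergences are positive
real numbers. -/
structure IsTestingPair {n : ℕ} {Ω : Fin n → Type u} [∀ j, MeasurableSpace (Ω j)]
    (μ : ∀ j, Measure (Ω j)) [∀ j, SigmaFinite (μ j)] (φ₀ φ₁ : ∀ j, Ω j → ℝ) : Prop where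
  density_zero : ∀ j, IsDensity (μ j) (φ₀ j)
  density_one : ∀ j, IsDensity (μ j) (φ₁ j)
  kl_zero_one_pos : 0 < InformationTheory.klDiv
    (densityMeasure (Measure.pi μ) (prodDensity φ₀)) (densityMeasure (Measure.pi μ) (prodDensity φ₁))
  kl_zero_one_lt_top : InformationTheory.klDiv
    (densityMeasure (Measure.pi μ) (prodDensity φ₀))
    (densityMeasure (Measure.pi μ) (prodDensity φ₁)) < (⊤ : ℝ≥0∞)
  kl_one_zero_pos : 0 < InformationTheory.klDiv
    (densityMeasure (Measure.pi μ) (prodDensity φ₁)) (densityMeasure (Measure.pi μ) (prodDensity φ₀))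
  kl_one_zero_lt_top : InformationTheory.klDiv
    (densityMeasure (Measure.pi μ) (prodDensity φ₁))
    (densityMeasure (Measure.pi μ) (prodDensity φ₀)) < (⊤ : ℝ≥0∞)

/-- The Chernoff `α`-divergence `-log ∫ f^(1-α) g^α dν`. -/
def chernoffDiv {X : Type u} [MeasurableSpace X] (ν : Measure X) (f g : X → ℝ) (α : ℝ) : ℝ :=
  -Real.log (∫ x, f x ^ (1 - α) * g x ^ α ∂ν)

/-- `α` maximizes the Chernoff `α`-divergence over the open interval `(0, 1)`. -/
def IsChernoffPoint {X : Type u} [MeasurableSpace X] (ν : Measure X) (f g : X → ℝ) (α : ℝ) : Prop :=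
  α ∈ Set.Ioo (0 : ℝ) 1 ∧ IsMaxOn (chernoffDiv ν f g) (Set.Ioo 0 1) α

/-- The law of a variable with the normalized density `f^(1-α) g^α exp(chernoffDiv)`. -/
def chernoffMeasure {X : Type u} [MeasurableSpace X] (ν : Measure X) (f g : X → ℝ) (α : ℝ) :
    Measure X :=
  densityMeasure ν fun x => f x ^ (1 - α) * g x ^ α * Real.exp (chernoffDiv ν f g α)

/-- The log-likelihood ratio `log (f / g)`. -/
def logRatio {X : Type u} (f g : X → ℝ) (x : X) : ℝ := Real.log (f x / g x)

/-- The centered log-likelihood ratio, as a function of `Y` with law `chernoffMeasure ν f g α`. -/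
def centeredLogRatio {X : Type u} [MeasurableSpace X] (ν : Measure X) (f g : X → ℝ) (α : ℝ)
    (y : X) : ℝ :=
  logRatio f g y - ∫ x, logRatio f g x ∂(chernoffMeasure ν f g α)

/-- The variance of the centered log-likelihood ratio under `chernoffMeasure ν f g α`. -/
def varZ {X : Type u} [MeasurableSpace X] (ν : Measure X) (f g : X → ℝ) (α : ℝ) : ℝ :=
  variance (centeredLogRatio ν f g α) (chernoffMeasure ν f g α)

/-- The third absolute moment of the centered log-likelihood ratio under
`chernoffMeasure ν f g α`. -/
def absThirdMomentZ {X : Type u} [MeasurableSpace X] (ν : Measure X) (f g : X → ℝ) (α : ℝ) : ℝ :=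
  ∫ y, |centeredLogRatio ν f g α y| ^ 3 ∂(chernoffMeasure ν f g α)

/-- The root of the average variance of the centered log-likelihood ratios of the coordinates. -/
def sigmaBar {n : ℕ} {Ω : Fin n → Type u} [∀ j, MeasurableSpace (Ω j)]
    (μ : ∀ j, Measure (Ω j)) (φ₀ φ₁ : ∀ j, Ω j → ℝ) (α : ℝ) : ℝ :=
  Real.sqrt ((1 / (n : ℝ)) * ∑ j, varZ (μ j) (φ₀ j) (φ₁ j) α)

/-- The function `x ↦ exp (min (α x) ((α - 1) x))`. -/
def gFun (α x : ℝ) : ℝ := Real.exp (min (α * x) ((α - 1) * x))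

/-- The expectation of `gFun α (log (f / g) (Y))` for `Y` with law `chernoffMeasure ν f g α`. -/
def expectG {X : Type u} [MeasurableSpace X] (ν : Measure X) (f g : X → ℝ) (α : ℝ) : ℝ :=
  ∫ y, gFun α (logRatio f g y) ∂(chernoffMeasure ν f g α)

/-- The total variation affinity `∫ min(f, g) dν`. -/
def affinity {X : Type u} [MeasurableSpace X] (ν : Measure X) (f g : X → ℝ) : ℝ :=
  ∫ x, min (f x) (g x) ∂ν

/-- An exponential family of densities `h(x) exp(θᵀ T(x) - A(θ))` with respect to `ν`, with
parameter `θ` in a convex set `Θ` of a Euclidean space. The function `A` is smooth on `Θ`; as usual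
for a set that need not be open, this means that it is (the restriction of) a function that is
smooth at every point of `Θ`. -/
structure ExponentialFamily {X : Type u} [MeasurableSpace X] (ν : Measure X) (d : ℕ) where
  /-- the base function -/
  h : X → ℝ
  /-- the sufficient statistic -/
  T : X → EuclideanSpace ℝ (Fin d)
  /-- the log-partition function -/
  A : EuclideanSpace ℝ (Fin d) → ℝ
  /-- the parameter space -/
  Θ : Set (EuclideanSpace ℝ (Fin d))
  measurable_h : Measurable h
  h_nonneg : ∀ x, 0 ≤ h x
  measurable_T : Measurable T
  convex_Θ : Convex ℝ Θ
  smooth_A : ∀ θ ∈ Θ, ContDiffAt ℝ ∞ A θ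
  integral_eq_one : ∀ θ ∈ Θ, ∫ x, h x * Real.exp (inner ℝ θ (T x) - A θ) ∂ν = 1

/-- The density of the exponential family at the parameter `θ`. -/
def ExponentialFamily.pdf {X : Type u} [MeasurableSpace X] {ν : Measure X} {d : ℕ}
    (E : ExponentialFamily ν d) (θ : EuclideanSpace ℝ (Fin d)) (x : X) : ℝ :=
  E.h x * Real.exp (inner ℝ θ (E.T x) - E.A θ)

/-- The Hessian matrix of second partial derivatives of `A` at `θ`. -/
def hessianMatrix {d : ℕ} (A : EuclideanSpace ℝ (Fin d) → ℝ) (θ : EuclideanSpace ℝ (Fin d)) :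
    Matrix (Fin d) (Fin d) ℝ :=
  Matrix.of fun i k =>
    iteratedFDeriv ℝ 2 A θ ![EuclideanSpace.single i 1, EuclideanSpace.single k 1]

/-- The quadratic form `vᵀ (Hess A(θ)) v`. -/
def hessianForm {d : ℕ} (A : EuclideanSpace ℝ (Fin d) → ℝ) (θ v : EuclideanSpace ℝ (Fin d)) : ℝ :=
  v.ofLp ⬝ᵥ (Matrix.mulVec (hessianMatrix A θ) v.ofLp)

end

/-!
For `0 < α < 1` one has `min f g = f ^ (1 - α) * g ^ α * gFun α (log (f / g))`, so the affinity is
`exp (-C_α)` times the expectation of `gFun α (log (f / g))` under the tilted density `φ_α`. Up to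
sign, `C_α` is the cumulant generating function of `log (g / f)` under `f`; hence its first
derivative is the mean of `log (f / g)` under `φ_α`, and minus its second derivative is the
variance. At the Chernoff point the mean vanishes, and for product densities the log-ratio becomes a
sum `S` of independent centered variables. For an exponential family `C_α` is the gap in the
convexity inequality for `A`, so the variance is a value of the Hessian form of `A`.

It remains to see that the expectation of `gFun α S` is of order `1 / (√V α (1 - α))`, where `V` is
the variance of `S`. Since `gFun α` is concentrated at scale `1 / (α (1 - α))`, this amounts to
showing that `S` charges long intervals near the origin as if it had a density of order `1 / √V`.
Both bounds come from Stein's method under the third moment condition. The Chen–Shao concentration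
inequality is the upper bound. For the lower bound, Stein's identity is applied to a truncation of
`S - x₀`, the upper bound for the leave-one-out sums controlling the error terms.
-/

/-! ### Sums of independent centered random variables -/

theorem integral_abs_le_sqrt_variance {Ω : Type*} [MeasurableSpace Ω] {P : Measure Ω}
    [IsProbabilityMeasure P] {Y : Ω → ℝ} (hY : MemLp Y 2 P) (h0 : ∫ w, Y w ∂P = 0) :
    ∫ w, |Y w| ∂P ≤ √Var[Y; P] := by
  have habs : 0 ≤ ∫ w, Y w ^ 2 ∂P - (∫ w, |Y w| ∂P) ^ 2 := by
    have := variance_nonneg |Y| P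
    rw [variance_eq_sub hY.abs] at this
    simpa only [Pi.pow_apply, Pi.abs_apply, sq_abs] using this
  rw [variance_of_integral_eq_zero hY.aemeasurable h0]
  exact Real.le_sqrt_of_sq_le (sub_nonneg.1 habs)

/-- A family of independent centered random variables with finite third absolute moments. -/
structure IsCenteredFamily {ι Ω : Type*} [MeasurableSpace Ω] (X : ι → Ω → ℝ) (P : Measure Ω) :
    Prop where
  measurable : ∀ i, Measurable (X i)
  indep : iIndepFun X P
  memLp : ∀ i, MemLp (X i) 3 P
  integral_eq_zero : ∀ i, ∫ w, X i w ∂P = 0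

namespace IsCenteredFamily

variable {ι Ω : Type*} [MeasurableSpace Ω] {P : Measure Ω} {X : ι → Ω → ℝ}

theorem measurable_sum (h : IsCenteredFamily X P) (s : Finset ι) : Measurable (∑ i ∈ s, X i) := by
  rw [Finset.sum_fn]
  exact Finset.measurable_sum _ fun i _ => h.measurable i

theorem integrable_abs_cube (h : IsCenteredFamily X P) (i : ι) :
    Integrable (fun w => |X i w| ^ 3) P := by
  simpa using (h.memLp i).integrable_norm_pow (by norm_num)

theorem integral_sq (h : IsCenteredFamily X P) (i : ι) : ∫ w, X i w ^ 2 ∂P = Var[X i; P] :=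
  (variance_of_integral_eq_zero (h.measurable i).aemeasurable (h.integral_eq_zero i)).symm

theorem indepFun_sum_sub (h : IsCenteredFamily X P) {s : Finset ι} {i : ι} (hi : i ∈ s) :
    IndepFun (X i) (∑ j ∈ s, X j - X i) P := by
  classical
  rw [← Finset.sum_erase_eq_sub hi]
  exact (h.indep.indepFun_finsetSum_of_notMem h.measurable (Finset.notMem_erase i s)).symm

variable [IsProbabilityMeasure P]

theorem memLp_two (h : IsCenteredFamily X P) (i : ι) : MemLp (X i) 2 P :=
  (h.memLp i).mono_exponent (by norm_num)

theorem integrable (h : IsCenteredFamily X P) (i : ι) : Integrable (X i) P :=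
  (h.memLp i).integrable (by norm_num)

theorem memLp_two_sum (h : IsCenteredFamily X P) (s : Finset ι) : MemLp (∑ i ∈ s, X i) 2 P :=
  memLp_finsetSum' _ fun i _ => h.memLp_two i

theorem integrable_sum (h : IsCenteredFamily X P) (s : Finset ι) : Integrable (∑ i ∈ s, X i) P :=
  (h.memLp_two_sum s).integrable (by norm_num)

theorem integral_sum (h : IsCenteredFamily X P) (s : Finset ι) :
    ∫ w, (∑ i ∈ s, X i) w ∂P = 0 := by
  simp only [Finset.sum_apply, integral_finsetSum s fun i _ => h.integrable i,
    h.integral_eq_zero, Finset.sum_const_zero]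

theorem variance_sum (h : IsCenteredFamily X P) (s : Finset ι) :
    Var[∑ i ∈ s, X i; P] = ∑ i ∈ s, Var[X i; P] :=
  IndepFun.variance_sum (fun i _ => h.memLp_two i) fun _ _ _ _ hij => h.indep.indepFun hij

theorem integral_abs_sum_le (h : IsCenteredFamily X P) (s : Finset ι) :
    ∫ w, |(∑ i ∈ s, X i) w| ∂P ≤ √Var[∑ i ∈ s, X i; P] :=
  integral_abs_le_sqrt_variance (h.memLp_two_sum s) (h.integral_sum s)

theorem integrable_mul_comp (h : IsCenteredFamily X P) (i : ι) {Y : Ω → ℝ} (hY : Measurable Y)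
    {f : ℝ → ℝ} (hf : Measurable f) {B : ℝ} (hB : ∀ x, |f x| ≤ B) :
    Integrable (fun w => X i w * f (Y w)) P :=
  (h.integrable i).mul_bdd (hf.comp hY).aestronglyMeasurable (.of_forall fun w => hB (Y w))

theorem integrable_mul_comp_sub_comp (h : IsCenteredFamily X P) (s : Finset ι) (i : ι)
    {f : ℝ → ℝ} (hf : Measurable f) {B : ℝ} (hB : ∀ x, |f x| ≤ B) :
    Integrable (fun w => X i w * (f ((∑ j ∈ s, X j) w) - f ((∑ j ∈ s, X j - X i) w))) P := by
  simp only [mul_sub]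
  exact (h.integrable_mul_comp i (h.measurable_sum s) hf hB).sub
    (h.integrable_mul_comp i ((h.measurable_sum s).sub (h.measurable i)) hf hB)

/-- Each `X i` is centered and independent of the sum of the others, so subtracting `f` of that sum
costs nothing. -/
theorem integral_sum_mul_comp_sum (h : IsCenteredFamily X P) (s : Finset ι) {f : ℝ → ℝ}
    (hf : Measurable f) {B : ℝ} (hB : ∀ x, |f x| ≤ B) :
    ∫ w, (∑ i ∈ s, X i) w * f ((∑ i ∈ s, X i) w) ∂P =
      ∑ i ∈ s, ∫ w, X i w * (f ((∑ j ∈ s, X j) w) - f ((∑ j ∈ s, X j - X i) w)) ∂P := by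
  have hS := h.measurable_sum s
  have hleave (i : ι) (hi : i ∈ s) : ∫ w, X i w * f ((∑ j ∈ s, X j - X i) w) ∂P = 0 := by
    have hind : IndepFun (X i) (f ∘ (∑ j ∈ s, X j - X i)) P :=
      (h.indepFun_sum_sub hi).comp measurable_id hf
    refine (hind.integral_fun_mul_eq_mul_integral (h.measurable i).aestronglyMeasurable
      (hf.comp (hS.sub (h.measurable i))).aestronglyMeasurable).trans ?_
    rw [h.integral_eq_zero i, zero_mul]
  calc ∫ w, (∑ i ∈ s, X i) w * f ((∑ i ∈ s, X i) w) ∂P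
      = ∑ i ∈ s, ∫ w, X i w * f ((∑ j ∈ s, X j) w) ∂P := by
        rw [← integral_finsetSum s fun i _ => h.integrable_mul_comp i hS hf hB]
        simp only [Finset.sum_apply, Finset.sum_mul]
    _ = _ := Finset.sum_congr rfl fun i hi => by
        simp only [mul_sub]
        rw [integral_sub (h.integrable_mul_comp i hS hf hB)
          (h.integrable_mul_comp i (hS.sub (h.measurable i)) hf hB), hleave i hi, sub_zero]

theorem integrable_sum_mul_comp_sum (h : IsCenteredFamily X P) (s : Finset ι) {f : ℝ → ℝ}
    (hf : Measurable f) {B : ℝ} (hB : ∀ x, |f x| ≤ B) :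
    Integrable (fun w => (∑ i ∈ s, X i) w * f ((∑ i ∈ s, X i) w)) P :=
  (h.integrable_sum s).mul_bdd (hf.comp (h.measurable_sum s)).aestronglyMeasurable
    (.of_forall fun _ => hB _)

theorem integral_sum_mul_comp_sum_le (h : IsCenteredFamily X P) (s : Finset ι) {f : ℝ → ℝ}
    (hf : Measurable f) {B : ℝ} (hB : ∀ x, |f x| ≤ B) :
    ∫ w, (∑ i ∈ s, X i) w * f ((∑ i ∈ s, X i) w) ∂P ≤ B * √Var[∑ i ∈ s, X i; P] := by
  have hB0 : 0 ≤ B := (abs_nonneg _).trans (hB 0)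
  calc ∫ w, (∑ i ∈ s, X i) w * f ((∑ i ∈ s, X i) w) ∂P
      ≤ ∫ w, B * |(∑ i ∈ s, X i) w| ∂P := by
        refine integral_mono (h.integrable_sum_mul_comp_sum s hf hB)
          ((h.integrable_sum s).abs.const_mul B) fun w => (le_abs_self _).trans ?_
        rw [abs_mul, mul_comm]
        exact mul_le_mul_of_nonneg_right (hB _) (abs_nonneg _)
    _ ≤ B * √Var[∑ i ∈ s, X i; P] := by
        rw [integral_const_mul]
        exact mul_le_mul_of_nonneg_left (h.integral_abs_sum_le s) hB0

end IsCenteredFamily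

/-- The truncation of `x` to the interval `[-L, L]`, the test function of Stein's method here. -/
def clip (L x : ℝ) : ℝ := max (-L) (min L x)

theorem measurable_clip (L : ℝ) : Measurable (clip L) := by
  unfold clip
  fun_prop

theorem abs_clip_le {L : ℝ} (hL : 0 ≤ L) (x : ℝ) : |clip L x| ≤ L :=
  abs_le.2 ⟨le_max_left _ _, max_le (by linarith) (min_le_left _ _)⟩

theorem monotone_clip (L : ℝ) : Monotone (clip L) := fun _ _ hxy =>
  max_le_max le_rfl (min_le_min le_rfl hxy)

theorem abs_clip_sub_clip_le (L x y : ℝ) : |clip L x - clip L y| ≤ |x - y| := by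
  have hmax := abs_max_sub_max_le_abs (min L x) (min L y) (-L)
  have hmin := abs_min_sub_min_le_max L x L y
  simp only [sub_self, abs_zero, abs_nonneg, max_eq_right] at hmin
  simpa only [clip, max_comm (-L)] using hmax.trans hmin

theorem clip_of_abs_le {L x : ℝ} (h : |x| ≤ L) : clip L x = x := by
  rw [clip, min_eq_right (abs_le.1 h).2, max_eq_right (abs_le.1 h).1]

theorem clip_of_le {L x : ℝ} (hL : 0 ≤ L) (h : L ≤ x) : clip L x = L := by
  rw [clip, min_eq_left h, max_eq_right (by linarith)]

theorem clip_of_le_neg {L x : ℝ} (hL : 0 ≤ L) (h : x ≤ -L) : clip L x = -L := by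
  rw [clip, min_eq_right (by linarith), max_eq_left h]

theorem mul_clip_sub_clip_nonneg (L x z : ℝ) : 0 ≤ z * (clip L x - clip L (x - z)) := by
  rcases le_total 0 z with hz | hz
  · exact mul_nonneg hz (sub_nonneg.2 (monotone_clip L (by linarith)))
  · exact mul_nonneg_of_nonpos_of_nonpos hz (sub_nonpos.2 (monotone_clip L (by linarith)))

theorem mul_clip_sub_clip_le {L : ℝ} (hL : 0 ≤ L) (x z : ℝ) :
    z * (clip L x - clip L (x - z)) ≤ if |x - z| ≤ L + |z| then z ^ 2 else 0 := by
  split_ifs with h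
  · calc z * (clip L x - clip L (x - z))
        ≤ |z| * |clip L x - clip L (x - z)| := by rw [← abs_mul]; exact le_abs_self _
      _ ≤ |z| * |z| := mul_le_mul_of_nonneg_left
        ((abs_clip_sub_clip_le L x _).trans_eq (by rw [sub_sub_cancel])) (abs_nonneg z)
      _ = z ^ 2 := by rw [abs_mul_abs_self, sq]
  · have hz := abs_le.1 (le_refl |z|)
    rcases lt_abs.1 (not_le.1 h) with h | h
    · rw [clip_of_le hL (by linarith), clip_of_le hL (by linarith), sub_self, mul_zero]
    · rw [clip_of_le_neg hL (by linarith), clip_of_le_neg hL (by linarith), sub_self, mul_zero]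

theorem mul_abs_sub_sq_le_mul_clip {L : ℝ} (hL : 0 ≤ L) (x : ℝ) :
    L * |x| - L ^ 2 ≤ x * clip L x := by
  rcases le_total |x| L with h | h
  · rw [clip_of_abs_le h, ← abs_mul_abs_self x]
    nlinarith [abs_nonneg x]
  · rcases le_abs'.1 h with h | h
    · rw [clip_of_le_neg hL h, abs_of_nonpos (by linarith)]
      nlinarith
    · rw [clip_of_le hL h, abs_of_nonneg (by linarith)]
      nlinarith

/-- The square of `z`, replaced by `δ |z|` where `|z|` exceeds `δ`. -/
def truncSq (δ z : ℝ) : ℝ := |z| * min δ |z|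

theorem measurable_truncSq (δ : ℝ) : Measurable (truncSq δ) := by
  unfold truncSq
  fun_prop

theorem truncSq_nonneg {δ : ℝ} (hδ : 0 ≤ δ) (z : ℝ) : 0 ≤ truncSq δ z :=
  mul_nonneg (abs_nonneg z) (le_min hδ (abs_nonneg z))

theorem truncSq_le (δ z : ℝ) : truncSq δ z ≤ δ * |z| := by
  rw [mul_comm]
  exact mul_le_mul_of_nonneg_left (min_le_left _ _) (abs_nonneg z)

theorem sq_sub_abs_cube_div_le_truncSq {δ : ℝ} (hδ : 0 < δ) (z : ℝ) :
    z ^ 2 - |z| ^ 3 / (4 * δ) ≤ truncSq δ z := by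
  have hfactor : z ^ 2 - |z| ^ 3 / (4 * δ) = |z| * (|z| - |z| ^ 2 / (4 * δ)) := by
    rw [← sq_abs]
    field_simp
  have hdiv : 0 ≤ |z| ^ 2 / (4 * δ) := by positivity
  have hδz : |z| - |z| ^ 2 / (4 * δ) ≤ δ := by
    rw [sub_le_iff_le_add, ← sub_le_iff_le_add', le_div_iff₀ (by positivity)]
    nlinarith [sq_nonneg (|z| - 2 * δ)]
  rw [hfactor, truncSq]
  exact mul_le_mul_of_nonneg_left (le_min hδz (by linarith)) (abs_nonneg z)

theorem truncSq_le_mul_clip_sub_clip {L δ x : ℝ} (hδ : 0 ≤ δ) (hx : |x| ≤ L - δ) (z : ℝ) :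
    truncSq δ z ≤ z * (clip L x - clip L (x - z)) := by
  rw [clip_of_abs_le (x := x) (by linarith), truncSq]
  obtain ⟨hx₁, hx₂⟩ := abs_le.1 hx
  have hmin := min_le_left δ |z|
  rcases le_total 0 z with hz | hz
  · have hclip : clip L (x - z) ≤ x - min δ |z| :=
      max_le (by linarith) ((min_le_right _ _).trans (by
        linarith [min_le_right δ |z|, abs_of_nonneg hz]))
    rw [abs_of_nonneg hz] at hclip ⊢
    exact mul_le_mul_of_nonneg_left (by linarith) hz
  · have hclip : x + min δ |z| ≤ clip L (x - z) :=
      le_max_of_le_right (le_min (by linarith) (by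
        linarith [min_le_right δ |z|, abs_of_nonpos hz]))
    rw [abs_of_nonpos hz] at hclip ⊢
    nlinarith

theorem measureReal_mul_half_le_setIntegral_add_variance {Ω : Type*} [MeasurableSpace Ω]
    {P : Measure Ω} [IsProbabilityMeasure P] {Y : Ω → ℝ} (hY : MemLp Y 2 P)
    (hpos : 0 < ∫ w, Y w ∂P) {I : Set Ω} (hI : MeasurableSet I) :
    P.real I * ((∫ w, Y w ∂P) / 2) ≤
      ∫ w in I, Y w ∂P + Var[Y; P] / (2 * ∫ w, Y w ∂P) := by
  set m := ∫ w, Y w ∂P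
  have hsq : Integrable (fun w => (Y w - m) ^ 2 / (2 * m)) P :=
    (hY.sub (memLp_const m)).integrable_sq.div_const _
  have hYint : IntegrableOn Y I P := (hY.integrable (by norm_num)).integrableOn
  calc P.real I * (m / 2) = ∫ _ in I, m / 2 ∂P := by rw [setIntegral_const, smul_eq_mul]
    _ ≤ ∫ w in I, (Y w + (Y w - m) ^ 2 / (2 * m)) ∂P := by
        refine setIntegral_mono_on (integrable_const _).integrableOn
          (hYint.add hsq.integrableOn) hI fun w _ => ?_
        have hcomplete : Y w + (Y w - m) ^ 2 / (2 * m) - m / 2 = Y w ^ 2 / (2 * m) := by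
          field_simp
          ring
        have : 0 ≤ Y w ^ 2 / (2 * m) := by positivity
        linarith
    _ = ∫ w in I, Y w ∂P + ∫ w in I, (Y w - m) ^ 2 / (2 * m) ∂P :=
        integral_add hYint hsq.integrableOn
    _ ≤ ∫ w in I, Y w ∂P + ∫ w, (Y w - m) ^ 2 / (2 * m) ∂P :=
        add_le_add_right (setIntegral_le_integral hsq (.of_forall fun w => by positivity)) _
    _ = _ := by rw [integral_div, variance_eq_integral hY.aemeasurable]

namespace IsCenteredFamily

variable {ι Ω : Type*} [MeasurableSpace Ω] {P : Measure Ω} [IsProbabilityMeasure P]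
  {X : ι → Ω → ℝ}

theorem memLp_two_truncSq_comp (h : IsCenteredFamily X P) {δ : ℝ} (hδ : 0 ≤ δ) (i : ι) :
    MemLp (truncSq δ ∘ X i) 2 P := by
  refine ((h.memLp_two i).const_mul δ).mono
    ((measurable_truncSq δ).comp (h.measurable i)).aestronglyMeasurable (.of_forall fun w => ?_)
  rw [Function.comp_apply, norm_mul, Real.norm_of_nonneg (truncSq_nonneg hδ _),
    Real.norm_of_nonneg hδ]
  exact truncSq_le _ _

theorem half_variance_sum_le_integral_truncSq (h : IsCenteredFamily X P) (s : Finset ι) {δ : ℝ}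
    (hδ : 0 < δ) (h3 : ∑ i ∈ s, ∫ w, |X i w| ^ 3 ∂P ≤ 2 * δ * Var[∑ i ∈ s, X i; P]) :
    Var[∑ i ∈ s, X i; P] / 2 ≤ ∫ w, (∑ i ∈ s, truncSq δ ∘ X i) w ∂P := by
  have hint (i : ι) : Integrable (truncSq δ ∘ X i) P :=
    (h.memLp_two_truncSq_comp hδ.le i).integrable (by norm_num)
  have hterm (i : ι) : Var[X i; P] - (∫ w, |X i w| ^ 3 ∂P) / (4 * δ) ≤
      ∫ w, (truncSq δ ∘ X i) w ∂P := by
    have hcube := (h.integrable_abs_cube i).div_const (4 * δ)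
    rw [← h.integral_sq, ← integral_div, ← integral_sub (h.memLp_two i).integrable_sq hcube]
    exact integral_mono ((h.memLp_two i).integrable_sq.sub hcube) (hint i)
      fun w => sq_sub_abs_cube_div_le_truncSq hδ _
  calc Var[∑ i ∈ s, X i; P] / 2
      ≤ Var[∑ i ∈ s, X i; P] - (∑ i ∈ s, ∫ w, |X i w| ^ 3 ∂P) / (4 * δ) := by
        have : (∑ i ∈ s, ∫ w, |X i w| ^ 3 ∂P) / (4 * δ) ≤ Var[∑ i ∈ s, X i; P] / 2 := by
          rw [div_le_iff₀ (by positivity)]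
          linarith
        linarith
    _ = ∑ i ∈ s, (Var[X i; P] - (∫ w, |X i w| ^ 3 ∂P) / (4 * δ)) := by
        rw [Finset.sum_sub_distrib, ← Finset.sum_div, h.variance_sum]
    _ ≤ ∑ i ∈ s, ∫ w, (truncSq δ ∘ X i) w ∂P := Finset.sum_le_sum fun i _ => hterm i
    _ = ∫ w, (∑ i ∈ s, truncSq δ ∘ X i) w ∂P := by
        rw [← integral_finsetSum s fun i _ => hint i]
        simp only [Finset.sum_apply]

theorem variance_sum_truncSq_le (h : IsCenteredFamily X P) (s : Finset ι) {δ : ℝ} (hδ : 0 ≤ δ) :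
    Var[∑ i ∈ s, truncSq δ ∘ X i; P] ≤ δ ^ 2 * Var[∑ i ∈ s, X i; P] := by
  have hL := h.memLp_two_truncSq_comp hδ
  rw [IndepFun.variance_sum (fun i _ => hL i) fun i _ j _ hij => (h.indep.indepFun hij).comp
    (measurable_truncSq δ) (measurable_truncSq δ), h.variance_sum, Finset.mul_sum]
  refine Finset.sum_le_sum fun i _ =>
    (variance_le_expectation_sq (hL i).aestronglyMeasurable).trans ?_
  rw [← h.integral_sq, ← integral_const_mul]
  refine integral_mono (hL i).integrable_sq ((h.memLp_two i).integrable_sq.const_mul _) fun w => ?_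
  calc truncSq δ (X i w) ^ 2 ≤ (δ * |X i w|) ^ 2 :=
        pow_le_pow_left₀ (truncSq_nonneg hδ _) (truncSq_le _ _) 2
    _ = δ ^ 2 * X i w ^ 2 := by rw [mul_pow, sq_abs]

theorem setIntegral_truncSq_le (h : IsCenteredFamily X P) (s : Finset ι) {δ : ℝ} (hδ : 0 ≤ δ)
    {a b : ℝ} (hab : a ≤ b) :
    ∫ w in (∑ i ∈ s, X i) ⁻¹' Set.Icc a b, (∑ i ∈ s, truncSq δ ∘ X i) w ∂P ≤
      ((b - a) / 2 + δ) * √Var[∑ i ∈ s, X i; P] := by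
  -- The increments of `f` dominate `truncSq δ` as long as the sum stays in `[a, b]`.
  set S := ∑ i ∈ s, X i
  set L := (b - a) / 2 + δ with hLdef
  set f : ℝ → ℝ := fun x => clip L (x - (a + b) / 2)
  have hL : 0 ≤ L := by have := sub_nonneg.2 hab; positivity
  have hfm : Measurable f := (measurable_clip L).comp (measurable_id.sub_const _)
  have hf (x : ℝ) : |f x| ≤ L := abs_clip_le hL _
  have hint (i : ι) : Integrable (fun w => X i w * (f (S w) - f ((S - X i) w))) P :=
    h.integrable_mul_comp_sub_comp s i hfm hf
  have hf_sub (x z : ℝ) : f (x - z) = clip L (x - (a + b) / 2 - z) := by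
    simp only [f, sub_right_comm]
  have hnonneg (i : ι) (w : Ω) : 0 ≤ X i w * (f (S w) - f ((S - X i) w)) := by
    rw [Pi.sub_apply, hf_sub]
    exact mul_clip_sub_clip_nonneg L _ _
  have hmem (i : ι) (w : Ω) (hw : a ≤ S w ∧ S w ≤ b) :
      truncSq δ (X i w) ≤ X i w * (f (S w) - f ((S - X i) w)) := by
    rw [Pi.sub_apply, hf_sub]
    exact truncSq_le_mul_clip_sub_clip hδ (abs_le.2 ⟨by linarith, by linarith⟩) _
  calc ∫ w in S ⁻¹' Set.Icc a b, (∑ i ∈ s, truncSq δ ∘ X i) w ∂P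
      ≤ ∫ w in S ⁻¹' Set.Icc a b, ∑ i ∈ s, X i w * (f (S w) - f ((S - X i) w)) ∂P := by
        refine setIntegral_mono_on ((memLp_finsetSum' s fun i _ =>
          h.memLp_two_truncSq_comp hδ i).integrable (by norm_num)).integrableOn
          (integrable_finsetSum s fun i _ => hint i).integrableOn
          (h.measurable_sum s measurableSet_Icc) fun w hw => ?_
        rw [Finset.sum_apply]
        exact Finset.sum_le_sum fun i _ => hmem i w hw
    _ ≤ ∫ w, ∑ i ∈ s, X i w * (f (S w) - f ((S - X i) w)) ∂P :=
        setIntegral_le_integral (integrable_finsetSum s fun i _ => hint i)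
          (.of_forall fun w => Finset.sum_nonneg fun i _ => hnonneg i w)
    _ = ∫ w, S w * f (S w) ∂P := by
        rw [integral_finsetSum s fun i _ => hint i, h.integral_sum_mul_comp_sum s hfm hf]
    _ ≤ L * √Var[S; P] := h.integral_sum_mul_comp_sum_le s hfm hf

/-- The Chen–Shao concentration inequality. On the event `S ∈ [a, b]` the sum of the truncated
squares is close to its mean, which is of order `V`, while Stein's identity bounds its integral
there by a multiple of `√V`. -/
theorem measureReal_sum_preimage_Icc_le (h : IsCenteredFamily X P) (s : Finset ι) {δ : ℝ}
    (hδ : 0 < δ) (hV : 0 < Var[∑ i ∈ s, X i; P])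
    (h3 : ∑ i ∈ s, ∫ w, |X i w| ^ 3 ∂P ≤ 2 * δ * Var[∑ i ∈ s, X i; P])
    {a b : ℝ} (hab : a ≤ b) :
    P.real ((∑ i ∈ s, X i) ⁻¹' Set.Icc a b) * (Var[∑ i ∈ s, X i; P] / 4) ≤
      ((b - a) / 2 + δ) * √Var[∑ i ∈ s, X i; P] + δ ^ 2 := by
  have hmean := h.half_variance_sum_le_integral_truncSq s hδ h3
  have hset := h.setIntegral_truncSq_le s hδ.le hab
  have hsplit := measureReal_mul_half_le_setIntegral_add_variance
    (memLp_finsetSum' s fun i _ => h.memLp_two_truncSq_comp hδ.le i) (by linarith)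
    (h.measurable_sum s (measurableSet_Icc (a := a) (b := b)))
  set m := ∫ w, (∑ i ∈ s, truncSq δ ∘ X i) w ∂P
  have hvar : Var[∑ i ∈ s, truncSq δ ∘ X i; P] / (2 * m) ≤ δ ^ 2 := by
    rw [div_le_iff₀ (by linarith)]
    refine (h.variance_sum_truncSq_le s hδ.le).trans ?_
    gcongr
    linarith
  calc P.real ((∑ i ∈ s, X i) ⁻¹' Set.Icc a b) * (Var[∑ i ∈ s, X i; P] / 4)
      ≤ P.real ((∑ i ∈ s, X i) ⁻¹' Set.Icc a b) * (m / 2) :=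
        mul_le_mul_of_nonneg_left (by linarith) measureReal_nonneg
    _ ≤ _ := by linarith

end IsCenteredFamily

/-! ### Concentration bounds -/

/-- `Y` concentrates on intervals as if it had a density bounded by `B`, up to an error `B`, the
contribution of an interval of unit length. -/
def HasConcentrationBound {Ω : Type*} [MeasurableSpace Ω] (Y : Ω → ℝ) (P : Measure Ω) (B : ℝ) :
    Prop :=
  ∀ a b : ℝ, a ≤ b → P.real (Y ⁻¹' Set.Icc a b) ≤ B * (b - a + 1)

namespace HasConcentrationBound

variable {Ω : Type*} [MeasurableSpace Ω] {P : Measure Ω} {Y : Ω → ℝ} {B : ℝ}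

theorem nonneg (h : HasConcentrationBound Y P B) : 0 ≤ B :=
  (measureReal_nonneg.trans (h 0 0 le_rfl)).trans_eq (by ring)

theorem mono (h : HasConcentrationBound Y P B) {C : ℝ} (hBC : B ≤ C) :
    HasConcentrationBound Y P C := fun a b hab =>
  (h a b hab).trans (mul_le_mul_of_nonneg_right hBC (by linarith))

theorem sub_const (h : HasConcentrationBound Y P B) (c : ℝ) :
    HasConcentrationBound (fun w => Y w - c) P B := fun a b hab => by
  have hpre : (fun w => Y w - c) ⁻¹' Set.Icc a b = Y ⁻¹' Set.Icc (a + c) (b + c) := by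
    rw [← Set.preimage_sub_const_Icc, ← Set.preimage_comp]
    rfl
  rw [hpre]
  exact (h _ _ (by linarith)).trans_eq (by ring)

theorem measureReal_abs_le (h : HasConcentrationBound Y P B) {t : ℝ} (ht : 0 ≤ t) :
    P.real {w | |Y w| ≤ t} ≤ B * (2 * t + 1) := by
  have hpre : {w | |Y w| ≤ t} = Y ⁻¹' Set.Icc (-t) t :=
    Set.ext fun w => abs_le (a := Y w)
  rw [hpre]
  exact (h _ _ (by linarith)).trans_eq (by ring)

theorem measureReal_abs_le_add (h : HasConcentrationBound Y P B) [IsFiniteMeasure P] (a : ℝ)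
    {t : ℝ} (ht : 0 ≤ t) :
    P.real {w | |Y w| ≤ a + t} ≤ P.real {w | |Y w| ≤ a} + 2 * B * (t + 1) := by
  have hsub : {w | |Y w| ≤ a + t} ⊆
      {w | |Y w| ≤ a} ∪ (Y ⁻¹' Set.Icc a (a + t) ∪ Y ⁻¹' Set.Icc (-(a + t)) (-a)) := by
    intro w hw
    obtain ⟨hw₁, hw₂⟩ := abs_le.1 (show |Y w| ≤ a + t from hw)
    rcases le_or_gt |Y w| a with ha | ha
    · exact Or.inl ha
    · rcases lt_abs.1 ha with ha | ha
      · exact Or.inr (Or.inl ⟨ha.le, hw₂⟩)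
      · exact Or.inr (Or.inr ⟨hw₁, by linarith⟩)
  calc P.real {w | |Y w| ≤ a + t}
      ≤ P.real {w | |Y w| ≤ a} +
          (P.real (Y ⁻¹' Set.Icc a (a + t)) + P.real (Y ⁻¹' Set.Icc (-(a + t)) (-a))) :=
        (measureReal_mono hsub).trans ((measureReal_union_le _ _).trans
          (add_le_add_right (measureReal_union_le _ _) _))
    _ ≤ P.real {w | |Y w| ≤ a} + (B * (a + t - a + 1) + B * (-a - -(a + t) + 1)) := by
        gcongr
        · exact h _ _ (by linarith)
        · exact h _ _ (by linarith)
    _ = P.real {w | |Y w| ≤ a} + 2 * B * (t + 1) := by ring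

theorem inv_le_integral_abs (h : HasConcentrationBound Y P B) [IsProbabilityMeasure P]
    (hY : Integrable Y P) (hYm : Measurable Y) (hB : 0 < B) (hB4 : 4 * B ≤ 1) :
    1 / (16 * B) ≤ ∫ w, |Y w| ∂P := by
  have hhalf : P.real {w | |Y w| ≤ 1 / (8 * B)} ≤ 1 / 2 := by
    refine (h.measureReal_abs_le (by positivity)).trans ?_
    have : B * (2 * (1 / (8 * B)) + 1) = 1 / 4 + B := by field_simp; ring
    linarith
  have hcompl : 1 / 2 ≤ P.real {w | 1 / (8 * B) ≤ |Y w|} := by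
    have hm : MeasurableSet {w | |Y w| ≤ 1 / (8 * B)} := measurableSet_le hYm.abs measurable_const
    have hsub : {w | |Y w| ≤ 1 / (8 * B)}ᶜ ⊆ {w | 1 / (8 * B) ≤ |Y w|} :=
      fun w hw => (not_le.1 (show ¬ |Y w| ≤ 1 / (8 * B) from hw)).le
    linarith [measureReal_mono (μ := P) hsub, probReal_compl_eq_one_sub (μ := P) hm]
  calc 1 / (16 * B) = 1 / (8 * B) * (1 / 2) := by field_simp; norm_num
    _ ≤ 1 / (8 * B) * P.real {w | 1 / (8 * B) ≤ |Y w|} := by gcongr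
    _ ≤ ∫ w, |Y w| ∂P :=
        mul_meas_ge_le_integral_of_nonneg (.of_forall fun w => abs_nonneg _) hY.abs _

end HasConcentrationBound

theorem sq_le_sq_add_abs_cube_div {t : ℝ} (ht : 0 < t) (z : ℝ) : z ^ 2 ≤ t ^ 2 + |z| ^ 3 / t := by
  rw [← sq_abs]
  rcases le_total |z| t with h | h
  · have : 0 ≤ |z| ^ 3 / t := by positivity
    nlinarith [abs_nonneg z]
  · have : |z| ^ 2 ≤ |z| ^ 3 / t := by
      rw [le_div_iff₀ ht, pow_succ |z| 2]
      gcongr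
    nlinarith [sq_nonneg t]

section IndependentPair

variable {Ω : Type*} [MeasurableSpace Ω] {P : Measure Ω} [IsProbabilityMeasure P]

theorem integral_sq_le_of_memLp_three {X : Ω → ℝ} (hX : MemLp X 3 P) {t : ℝ} (ht : 0 < t) :
    ∫ w, X w ^ 2 ∂P ≤ t ^ 2 + (∫ w, |X w| ^ 3 ∂P) / t := by
  have hsq : Integrable (fun w => X w ^ 2) P :=
    (hX.mono_exponent (by norm_num : (2 : ℝ≥0∞) ≤ 3)).integrable_sq
  have hcube : Integrable (fun w => |X w| ^ 3 / t) P :=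
    Integrable.div_const (by simpa using hX.integrable_norm_pow (by norm_num)) t
  refine (integral_mono hsq ((integrable_const (t ^ 2)).add hcube)
    fun w => sq_le_sq_add_abs_cube_div ht (X w)).trans_eq ?_
  rw [Pi.add_def, integral_add (integrable_const _) hcube, integral_div, integral_const,
    probReal_univ, one_smul]

theorem integral_comp_le_of_indepFun {β γ : Type*} [MeasurableSpace β] [MeasurableSpace γ]
    {X : Ω → β} {Y : Ω → γ} (hX : Measurable X) (hY : Measurable Y) (hXY : IndepFun X Y P)
    {F : β × γ → ℝ} {G : β → ℝ} (hF : Measurable F) (hG : Measurable G)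
    (hFint : Integrable (fun w => F (X w, Y w)) P) (hGint : Integrable (fun w => G (X w)) P)
    (hFG : ∀ x, ∫ w, F (x, Y w) ∂P ≤ G x) :
    ∫ w, F (X w, Y w) ∂P ≤ ∫ w, G (X w) ∂P := by
  have hmap := (indepFun_iff_map_prod_eq_prod_map_map hX.aemeasurable hY.aemeasurable).1 hXY
  have := Measure.isProbabilityMeasure_map (μ := P) hX.aemeasurable
  have := Measure.isProbabilityMeasure_map (μ := P) hY.aemeasurable
  have hFprod : Integrable F ((P.map X).prod (P.map Y)) := by
    rw [← hmap]
    exact (integrable_map_measure hF.aestronglyMeasurable (hX.prodMk hY).aemeasurable).2 hFint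
  calc ∫ w, F (X w, Y w) ∂P = ∫ q, F q ∂((P.map X).prod (P.map Y)) := by
        rw [← hmap, integral_map (hX.prodMk hY).aemeasurable hF.aestronglyMeasurable]
    _ = ∫ x, ∫ y, F (x, y) ∂(P.map Y) ∂(P.map X) := integral_prod F hFprod
    _ ≤ ∫ x, G x ∂(P.map X) := by
        refine integral_mono hFprod.integral_prod_left
          ((integrable_map_measure hG.aestronglyMeasurable hX.aemeasurable).2 hGint) fun x => ?_
        exact (integral_map hY.aemeasurable
          (hF.comp measurable_prodMk_left).aestronglyMeasurable).trans_le (hFG x)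
    _ = ∫ w, G (X w) ∂P := integral_map hX.aemeasurable hG.aestronglyMeasurable

variable {X Y : Ω → ℝ} {B : ℝ}

theorem HasConcentrationBound.integral_mul_clip_sub_clip_le_measureReal_left
    (hB : HasConcentrationBound Y P B) (hX : Measurable X) (hY : Measurable Y)
    (hXY : IndepFun X Y P) (hX3 : MemLp X 3 P) {a : ℝ} (ha : 0 ≤ a) :
    ∫ w, X w * (clip a (Y w + X w) - clip a (Y w)) ∂P ≤
      (∫ w, X w ^ 2 ∂P) * P.real {w | |Y w| ≤ a} +
        2 * B * (∫ w, |X w| ^ 3 ∂P + ∫ w, X w ^ 2 ∂P) := by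
  set p := P.real {w | |Y w| ≤ a}
  set F : ℝ × ℝ → ℝ := {q | |q.2| ≤ a + |q.1|}.indicator fun q => q.1 ^ 2
  have hset : MeasurableSet {q : ℝ × ℝ | |q.2| ≤ a + |q.1|} :=
    measurableSet_le (by fun_prop) (by fun_prop)
  have hF : Measurable F := (measurable_fst.pow_const 2).indicator hset
  have hsq : Integrable (fun w => X w ^ 2) P :=
    (hX3.mono_exponent (by norm_num : (2 : ℝ≥0∞) ≤ 3)).integrable_sq
  have hcube : Integrable (fun w => |X w| ^ 3) P := by
    simpa using hX3.integrable_norm_pow (by norm_num)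
  have hFint : Integrable (fun w => F (X w, Y w)) P := hsq.indicator ((hX.prodMk hY) hset)
  have hclip : Integrable (fun w => X w * (clip a (Y w + X w) - clip a (Y w))) P :=
    (hX3.integrable (by norm_num)).mul_bdd (c := a + a)
      (((measurable_clip a).comp (hY.add hX)).sub
        ((measurable_clip a).comp hY)).aestronglyMeasurable
      (.of_forall fun w => (abs_sub _ _).trans (add_le_add (abs_clip_le ha _) (abs_clip_le ha _)))
  have hslice (x : ℝ) : ∫ w, F (x, Y w) ∂P ≤ x ^ 2 * p + 2 * B * (|x| ^ 3 + x ^ 2) := by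
    have hind : (fun w => F (x, Y w)) = {w | |Y w| ≤ a + |x|}.indicator fun _ => x ^ 2 := rfl
    rw [hind, integral_indicator_const _ (measurableSet_le hY.abs measurable_const), smul_eq_mul]
    refine (mul_le_mul_of_nonneg_right (hB.measureReal_abs_le_add a (abs_nonneg x))
      (sq_nonneg x)).trans_eq ?_
    rw [pow_succ |x| 2, sq_abs]
    ring
  calc ∫ w, X w * (clip a (Y w + X w) - clip a (Y w)) ∂P
      ≤ ∫ w, F (X w, Y w) ∂P := by
        refine integral_mono hclip hFint fun w => ?_
        have := mul_clip_sub_clip_le ha (Y w + X w) (X w)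
        rw [add_sub_cancel_right] at this
        simpa only [F, Set.indicator_apply, Set.mem_ofPred_eq] using this
    _ ≤ ∫ w, (X w ^ 2 * p + 2 * B * (|X w| ^ 3 + X w ^ 2)) ∂P :=
        integral_comp_le_of_indepFun hX hY hXY (G := fun x => x ^ 2 * p + 2 * B * (|x| ^ 3 + x ^ 2))
          hF (by fun_prop) hFint ((hsq.mul_const p).add ((hcube.add hsq).const_mul _)) hslice
    _ = _ := by
        have hrem : Integrable (fun w => 2 * B * (|X w| ^ 3 + X w ^ 2)) P :=
          (hcube.add hsq).const_mul _
        rw [integral_add (hsq.mul_const p) hrem, integral_mul_const, integral_const_mul,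
          integral_add hcube hsq]

theorem integral_sq_mul_measureReal_lt_abs_le (hX : MemLp X 3 P) {a : ℝ} (ha : 0 < a) :
    (∫ w, X w ^ 2 ∂P) * P.real {w | a < |X w|} ≤ 2 * (∫ w, |X w| ^ 3 ∂P) / a := by
  set ρ := ∫ w, |X w| ^ 3 ∂P
  set q := P.real {w | a < |X w|}
  have hmarkov : a ^ 3 * q ≤ ρ := by
    refine le_trans ?_ (mul_meas_ge_le_integral_of_nonneg (.of_forall fun w => by positivity)
      (by simpa using hX.integrable_norm_pow (by norm_num)) (a ^ 3))
    exact mul_le_mul_of_nonneg_left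
      (measureReal_mono fun w hw => pow_le_pow_left₀ ha.le (le_of_lt hw) 3) (by positivity)
  have hρ : 0 ≤ ρ := integral_nonneg fun w => by positivity
  calc (∫ w, X w ^ 2 ∂P) * q ≤ (a ^ 2 + ρ / a) * q :=
        mul_le_mul_of_nonneg_right (integral_sq_le_of_memLp_three hX ha) measureReal_nonneg
    _ = a ^ 3 * q / a + ρ / a * q := by field_simp
    _ ≤ ρ / a + ρ / a * 1 := by
        gcongr
        exact measureReal_le_one
    _ = 2 * ρ / a := by ring

theorem HasConcentrationBound.integral_sq_mul_measureReal_abs_le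
    (hB : HasConcentrationBound Y P B) (hXY : IndepFun X Y P) (hX3 : MemLp X 3 P) {a : ℝ}
    (ha : 1 ≤ a) :
    (∫ w, X w ^ 2 ∂P) * P.real {w | |Y w| ≤ a} ≤
      (∫ w, X w ^ 2 ∂P) * P.real {w | |Y w + X w| ≤ 2 * a} + 6 * B * ∫ w, |X w| ^ 3 ∂P := by
  have hinter : P.real ({w | a < |X w|} ∩ {w | |Y w| ≤ a}) =
      P.real {w | a < |X w|} * P.real {w | |Y w| ≤ a} := by
    have := congrArg ENNReal.toReal (hXY.measure_inter_preimage_eq_mul {x | a < |x|} {y | |y| ≤ a}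
      (measurableSet_lt measurable_const measurable_abs)
      (measurableSet_le measurable_abs measurable_const))
    rwa [ENNReal.toReal_mul] at this
  have hsub : {w | |Y w| ≤ a} ⊆
      {w | |Y w + X w| ≤ 2 * a} ∪ ({w | a < |X w|} ∩ {w | |Y w| ≤ a}) := by
    intro w hw
    rcases le_or_gt |X w| a with hXw | hXw
    · exact Or.inl <| show |Y w + X w| ≤ 2 * a from
        (abs_add_le _ _).trans (by linarith [show |Y w| ≤ a from hw])
    · exact Or.inr ⟨hXw, hw⟩
  have hunion : P.real {w | |Y w| ≤ a} ≤
      P.real {w | |Y w + X w| ≤ 2 * a} + P.real {w | a < |X w|} * P.real {w | |Y w| ≤ a} :=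
    hinter ▸ (measureReal_mono hsub).trans (measureReal_union_le _ _)
  have htail := integral_sq_mul_measureReal_lt_abs_le hX3 (by linarith : 0 < a)
  have hσ : 0 ≤ ∫ w, X w ^ 2 ∂P := integral_nonneg fun w => sq_nonneg _
  have : 0 ≤ ∫ w, |X w| ^ 3 ∂P := integral_nonneg fun w => by positivity
  have hsmall : P.real {w | |Y w| ≤ a} ≤ 3 * a * B :=
    (hB.measureReal_abs_le (by linarith)).trans (by nlinarith [hB.nonneg])
  have hproduct : (∫ w, X w ^ 2 ∂P) * P.real {w | a < |X w|} * P.real {w | |Y w| ≤ a} ≤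
      2 * (∫ w, |X w| ^ 3 ∂P) / a * (3 * a * B) := by gcongr
  have hcancel : 2 * (∫ w, |X w| ^ 3 ∂P) / a * (3 * a * B) = 6 * B * ∫ w, |X w| ^ 3 ∂P := by
    field_simp
    ring
  nlinarith [mul_le_mul_of_nonneg_left hunion hσ]

theorem HasConcentrationBound.integral_mul_clip_sub_clip_le_measureReal_add
    (hB : HasConcentrationBound Y P B) (hX : Measurable X) (hY : Measurable Y)
    (hXY : IndepFun X Y P) (hX3 : MemLp X 3 P) {a : ℝ} (ha : 1 ≤ a) :
    ∫ w, X w * (clip a (Y w + X w) - clip a (Y w)) ∂P ≤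
      (∫ w, X w ^ 2 ∂P) * P.real {w | |Y w + X w| ≤ 2 * a} +
        2 * B * (4 * ∫ w, |X w| ^ 3 ∂P + ∫ w, X w ^ 2 ∂P) := by
  linarith [hB.integral_mul_clip_sub_clip_le_measureReal_left hX hY hXY hX3 (by linarith : 0 ≤ a),
    hB.integral_sq_mul_measureReal_abs_le hXY hX3 ha]

end IndependentPair

namespace IsCenteredFamily

variable {ι Ω : Type*} [MeasurableSpace Ω] {P : Measure Ω} [IsProbabilityMeasure P]
  {X : ι → Ω → ℝ} {K : ℝ}

theorem hasConcentrationBound_sum (h : IsCenteredFamily X P) (s : Finset ι) (hK : 1 ≤ K)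
    (hV : 0 < Var[∑ i ∈ s, X i; P])
    (h3 : ∑ i ∈ s, ∫ w, |X i w| ^ 3 ∂P ≤ 2 * K * Var[∑ i ∈ s, X i; P]) :
    HasConcentrationBound (∑ i ∈ s, X i) P (8 * K ^ 2 / √Var[∑ i ∈ s, X i; P]) := by
  intro a b hab
  have hchen := h.measureReal_sum_preimage_Icc_le s (by linarith) hV h3 hab
  set r := √Var[∑ i ∈ s, X i; P]
  have hr : 0 < r := Real.sqrt_pos.2 hV
  have hK2 : K ≤ K ^ 2 := by nlinarith
  have hba : (b - a) ≤ K ^ 2 * (b - a) := by nlinarith [sub_nonneg.2 hab]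
  have hba' := sub_nonneg.2 hab
  rw [div_mul_eq_mul_div, le_div_iff₀ hr]
  rcases le_total r 1 with hr1 | hr1
  · calc P.real ((∑ i ∈ s, X i) ⁻¹' Set.Icc a b) * r ≤ 1 * 1 := by
          gcongr
          exact measureReal_le_one
      _ ≤ 8 * K ^ 2 * (b - a + 1) := by nlinarith
  · rw [← Real.sq_sqrt hV.le] at hchen
    refine le_of_mul_le_mul_right (a := r / 4) ?_ (by positivity)
    nlinarith [mul_le_mul_of_nonneg_right hr1 (sq_nonneg K)]

theorem variance_le_sq_add (h : IsCenteredFamily X P) (i : ι) {t : ℝ} (ht : 0 < t) :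
    Var[X i; P] ≤ t ^ 2 + (∫ w, |X i w| ^ 3 ∂P) / t :=
  (h.integral_sq i).symm.trans_le (integral_sq_le_of_memLp_three (h.memLp i) ht)

theorem hasConcentrationBound_sum_sub (h : IsCenteredFamily X P) {s : Finset ι} (hK : 1 ≤ K)
    (hV : 64 * K ^ 2 ≤ Var[∑ i ∈ s, X i; P])
    (h3 : ∑ i ∈ s, ∫ w, |X i w| ^ 3 ∂P ≤ K * Var[∑ i ∈ s, X i; P]) {i : ι} (hi : i ∈ s) :
    HasConcentrationBound (∑ j ∈ s, X j - X i) P (16 * K ^ 2 / √Var[∑ i ∈ s, X i; P]) := by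
  classical
  have hρ (j : ι) : 0 ≤ ∫ w, |X j w| ^ 3 ∂P := integral_nonneg fun w => by positivity
  have hρi : (∫ w, |X i w| ^ 3 ∂P) / (4 * K) ≤ Var[∑ i ∈ s, X i; P] / 4 := by
    rw [div_le_div_iff₀ (by positivity) (by norm_num)]
    linarith [Finset.single_le_sum (fun j _ => hρ j) hi]
  have hσi := h.variance_le_sq_add i (by positivity : 0 < 4 * K)
  have hvar : Var[∑ j ∈ s.erase i, X j; P] + Var[X i; P] = Var[∑ j ∈ s, X j; P] := by
    rw [h.variance_sum, h.variance_sum, Finset.sum_erase_add _ _ hi]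
  have hcube := Finset.sum_erase_add s (fun j => ∫ w, |X j w| ^ 3 ∂P) hi
  have hhalf : Var[∑ j ∈ s, X j; P] / 2 ≤ Var[∑ j ∈ s.erase i, X j; P] := by linarith
  have hV0 : 0 < Var[∑ j ∈ s, X j; P] := by nlinarith
  have hbound := h.hasConcentrationBound_sum (s.erase i) hK (by linarith)
    (by nlinarith [hρ i])
  rw [Finset.sum_erase_eq_sub hi] at hbound hhalf
  refine hbound.mono ?_
  have hsqrt : √Var[∑ j ∈ s, X j; P] / 2 ≤ √Var[∑ j ∈ s, X j - X i; P] := by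
    refine Real.le_sqrt_of_sq_le ?_
    rw [div_pow, Real.sq_sqrt hV0.le]
    linarith
  calc 8 * K ^ 2 / √Var[∑ j ∈ s, X j - X i; P]
      ≤ 8 * K ^ 2 / (√Var[∑ j ∈ s, X j; P] / 2) := by
        have := Real.sqrt_pos.2 hV0
        gcongr
    _ = 16 * K ^ 2 / √Var[∑ j ∈ s, X j; P] := by
        rw [div_div_eq_mul_div]
        ring

theorem integral_sum_mul_clip_sum_sub_le (h : IsCenteredFamily X P) (s : Finset ι) {B a : ℝ}
    (hB : 0 ≤ B) (ha : 1 ≤ a)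
    (hrest : ∀ i ∈ s, HasConcentrationBound (∑ j ∈ s, X j - X i) P B) (hK : 1 ≤ K)
    (h3 : ∑ i ∈ s, ∫ w, |X i w| ^ 3 ∂P ≤ K * Var[∑ i ∈ s, X i; P]) (x₀ : ℝ) :
    ∫ w, (∑ i ∈ s, X i) w * clip a ((∑ i ∈ s, X i) w - x₀) ∂P ≤
      Var[∑ i ∈ s, X i; P] * (P.real {w | |(∑ i ∈ s, X i) w - x₀| ≤ 2 * a} + 10 * K * B) := by
  set S := ∑ i ∈ s, X i with hS
  set p := P.real {w | |S w - x₀| ≤ 2 * a}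
  have hsub : Measurable fun x : ℝ => x - x₀ := measurable_id.sub_const _
  have hterm (i : ι) (hi : i ∈ s) :
      ∫ w, X i w * (clip a (S w - x₀) - clip a ((S - X i) w - x₀)) ∂P ≤
        Var[X i; P] * p + 2 * B * (4 * ∫ w, |X i w| ^ 3 ∂P + Var[X i; P]) := by
    have hadd (w : Ω) : (S - X i) w - x₀ + X i w = S w - x₀ := by
      rw [Pi.sub_apply]
      ring
    have := ((hrest i hi).sub_const x₀).integral_mul_clip_sub_clip_le_measureReal_add
      (h.measurable i) (hsub.comp ((h.measurable_sum s).sub (h.measurable i)))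
      ((h.indepFun_sum_sub hi).comp measurable_id hsub) (h.memLp i) ha
    simpa only [← hS, hadd, h.integral_sq] using this
  have hV : 0 ≤ Var[S; P] := variance_nonneg _ _
  calc ∫ w, S w * clip a (S w - x₀) ∂P
      = ∑ i ∈ s, ∫ w, X i w * (clip a (S w - x₀) - clip a ((S - X i) w - x₀)) ∂P :=
        h.integral_sum_mul_comp_sum s ((measurable_clip a).comp hsub)
          fun x => abs_clip_le (by linarith) (x - x₀)
    _ ≤ ∑ i ∈ s, (Var[X i; P] * p + 2 * B * (4 * ∫ w, |X i w| ^ 3 ∂P + Var[X i; P])) :=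
        Finset.sum_le_sum hterm
    _ = Var[S; P] * p + 2 * B * (4 * ∑ i ∈ s, ∫ w, |X i w| ^ 3 ∂P + Var[S; P]) := by
        rw [hS, h.variance_sum, Finset.sum_add_distrib, ← Finset.sum_mul, ← Finset.mul_sum,
          Finset.sum_add_distrib, Finset.mul_sum s _ 4]
    _ ≤ Var[S; P] * p + 2 * B * (4 * (K * Var[S; P]) + K * Var[S; P]) := by
        gcongr
        exact le_mul_of_one_le_left hV hK
    _ = Var[S; P] * (p + 10 * K * B) := by ring

theorem le_integral_sum_mul_clip_sum_sub (h : IsCenteredFamily X P) (s : Finset ι) {B a : ℝ}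
    (hB : 0 < B) (hB4 : 4 * B ≤ 1) (ha : 0 ≤ a) (hsum : HasConcentrationBound (∑ i ∈ s, X i) P B)
    (x₀ : ℝ) :
    a * (1 / (16 * B) - |x₀| - a) ≤
      ∫ w, (∑ i ∈ s, X i) w * clip a ((∑ i ∈ s, X i) w - x₀) ∂P := by
  set S := ∑ i ∈ s, X i
  have hSint : Integrable (fun w => S w - x₀) P := (h.integrable_sum s).sub (integrable_const _)
  have hSm : Measurable fun w => S w - x₀ := (h.measurable_sum s).sub_const _
  have hpoint (w : Ω) : a * |S w - x₀| - a * (|x₀| + a) ≤ S w * clip a (S w - x₀) := by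
    have hx₀ : -(|x₀| * a) ≤ x₀ * clip a (S w - x₀) := by
      refine neg_le_of_abs_le ?_
      rw [abs_mul]
      exact mul_le_mul_of_nonneg_left (abs_clip_le ha _) (abs_nonneg _)
    linarith [mul_abs_sub_sq_le_mul_clip ha (S w - x₀)]
  have hclip : Integrable (fun w => S w * clip a (S w - x₀)) P :=
    (h.integrable_sum s).mul_bdd (c := a) ((measurable_clip a).comp hSm).aestronglyMeasurable
      (.of_forall fun w => abs_clip_le ha _)
  calc a * (1 / (16 * B) - |x₀| - a) = a * (1 / (16 * B)) - a * (|x₀| + a) := by ring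
    _ ≤ a * ∫ w, |S w - x₀| ∂P - a * (|x₀| + a) := by
        gcongr
        exact (hsum.sub_const x₀).inv_le_integral_abs hSint hSm hB hB4
    _ = ∫ w, (a * |S w - x₀| - a * (|x₀| + a)) ∂P := by
        rw [integral_sub (hSint.abs.const_mul a) (integrable_const _), integral_const_mul,
          integral_const, probReal_univ, one_smul]
    _ ≤ ∫ w, S w * clip a (S w - x₀) ∂P :=
        integral_mono ((hSint.abs.const_mul a).sub (integrable_const _)) hclip hpoint

/-- Stein's identity for the clipped test function. The left-hand side is of order `a √V`, while the
error on the right-hand side is of order `√V`, which a large `a` absorbs. -/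
theorem mul_sub_le_variance_mul_measureReal_abs_sum_sub_le_add (h : IsCenteredFamily X P)
    (s : Finset ι) (hK : 1 ≤ K)
    (h3 : ∑ i ∈ s, ∫ w, |X i w| ^ 3 ∂P ≤ K * Var[∑ i ∈ s, X i; P])
    (hV : 64 * K ^ 2 ≤ √Var[∑ i ∈ s, X i; P]) {a : ℝ} (ha : 1 ≤ a) (x₀ : ℝ) :
    a * (√Var[∑ i ∈ s, X i; P] / (256 * K ^ 2) - |x₀| - a) ≤
      Var[∑ i ∈ s, X i; P] * P.real {w | |(∑ i ∈ s, X i) w - x₀| ≤ 2 * a} +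
        160 * K ^ 3 * √Var[∑ i ∈ s, X i; P] := by
  have hK2 : 1 ≤ K ^ 2 := one_le_pow₀ hK
  set r := √Var[∑ i ∈ s, X i; P]
  have hr : 0 < r := by linarith
  have hVr : Var[∑ i ∈ s, X i; P] = r ^ 2 := (Real.sq_sqrt (variance_nonneg _ _)).symm
  have hB : 0 < 16 * K ^ 2 / r := by positivity
  have hB4 : 4 * (16 * K ^ 2 / r) ≤ 1 := by
    rw [← mul_div_assoc, div_le_one hr]
    linarith
  have hrest (i : ι) (hi : i ∈ s) :
      HasConcentrationBound (∑ j ∈ s, X j - X i) P (16 * K ^ 2 / r) :=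
    h.hasConcentrationBound_sum_sub hK (by nlinarith) h3 hi
  have hsum : HasConcentrationBound (∑ i ∈ s, X i) P (16 * K ^ 2 / r) :=
    (h.hasConcentrationBound_sum s hK (by rw [hVr]; positivity) (by nlinarith)).mono
      (by gcongr; norm_num)
  have hinv : 1 / (16 * (16 * K ^ 2 / r)) = r / (256 * K ^ 2) := by field_simp; norm_num
  have hstein := (h.le_integral_sum_mul_clip_sum_sub s hB hB4 (zero_le_one.trans ha) hsum x₀).trans
    (h.integral_sum_mul_clip_sum_sub_le s hB.le ha hrest hK h3 x₀)
  rw [hinv, hVr] at hstein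
  rw [hVr]
  refine hstein.trans_eq ?_
  field_simp
  ring

theorem le_measureReal_abs_sum_sub_le (h : IsCenteredFamily X P) (s : Finset ι) (hK : 1 ≤ K)
    (h3 : ∑ i ∈ s, ∫ w, |X i w| ^ 3 ∂P ≤ K * Var[∑ i ∈ s, X i; P]) {a x₀ : ℝ}
    (ha : 163840 * K ^ 5 ≤ a) (hx₀ : |x₀| + a ≤ √Var[∑ i ∈ s, X i; P] / (512 * K ^ 2)) :
    a / (1024 * K ^ 2 * √Var[∑ i ∈ s, X i; P]) ≤
      P.real {w | |(∑ i ∈ s, X i) w - x₀| ≤ 2 * a} := by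
  have hK2 : 1 ≤ K ^ 2 := one_le_pow₀ hK
  have ha1 : 1 ≤ a := by linarith [one_le_pow₀ hK (n := 5)]
  have hr : 512 * K ^ 2 ≤ √Var[∑ i ∈ s, X i; P] := by
    have := (le_div_iff₀ (by positivity)).1 hx₀
    nlinarith [abs_nonneg x₀]
  have hstein := h.mul_sub_le_variance_mul_measureReal_abs_sum_sub_le_add s hK h3 (by linarith) ha1
    x₀
  have hVr : Var[∑ i ∈ s, X i; P] = √Var[∑ i ∈ s, X i; P] ^ 2 :=
    (Real.sq_sqrt (variance_nonneg _ _)).symm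
  set r := √Var[∑ i ∈ s, X i; P]
  set p := P.real {w | |(∑ i ∈ s, X i) w - x₀| ≤ 2 * a}
  rw [hVr] at hstein
  have hr0 : 0 < r := by linarith
  have hhalf : r / (512 * K ^ 2) ≤ r / (256 * K ^ 2) - |x₀| - a := by
    have : r / (256 * K ^ 2) = 2 * (r / (512 * K ^ 2)) := by field_simp; norm_num
    linarith
  have hmain : a * (r / (512 * K ^ 2)) ≤ r ^ 2 * p + 160 * K ^ 3 * r :=
    (mul_le_mul_of_nonneg_left hhalf (by linarith)).trans hstein
  have hloss : 160 * K ^ 3 * r ≤ a * r / (1024 * K ^ 2) := by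
    rw [le_div_iff₀ (by positivity)]
    nlinarith
  refine le_of_mul_le_mul_left (a := r ^ 2) ?_ (by positivity)
  calc r ^ 2 * (a / (1024 * K ^ 2 * r))
      = a * (r / (512 * K ^ 2)) - a * r / (1024 * K ^ 2) := by field_simp; norm_num
    _ ≤ r ^ 2 * p := by linarith

end IsCenteredFamily

/-! ### Expectations of `gFun` -/

theorem measurable_gFun (α : ℝ) : Measurable (gFun α) := by
  unfold gFun
  fun_prop

theorem gFun_nonneg (α x : ℝ) : 0 ≤ gFun α x := (Real.exp_pos _).le

theorem gFun_le_one {α : ℝ} (hα : α ∈ Set.Icc (0 : ℝ) 1) (x : ℝ) : gFun α x ≤ 1 := by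
  refine Real.exp_le_one_iff.2 ?_
  rcases le_total 0 x with hx | hx
  · exact (min_le_right _ _).trans (mul_nonpos_of_nonpos_of_nonneg (by linarith [hα.2]) hx)
  · exact (min_le_left _ _).trans (mul_nonpos_of_nonneg_of_nonpos hα.1 hx)

theorem integrable_gFun_comp {Ω : Type*} [MeasurableSpace Ω] {P : Measure Ω} [IsFiniteMeasure P]
    {Y : Ω → ℝ} (hY : AEMeasurable Y P) {α : ℝ} (hα : α ∈ Set.Icc (0 : ℝ) 1) :
    Integrable (fun w => gFun α (Y w)) P :=
  Integrable.of_bound ((measurable_gFun α).comp_aemeasurable hY).aestronglyMeasurable 1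
    (.of_forall fun _ => (Real.norm_of_nonneg (gFun_nonneg _ _)).trans_le (gFun_le_one hα _))

theorem mem_Icc_of_lt_gFun {α t x : ℝ} (hα : α ∈ Set.Ioo (0 : ℝ) 1) (ht : 0 < t)
    (h : t < gFun α x) : x ∈ Set.Icc (Real.log t / α) (-Real.log t / (1 - α)) := by
  have hlog := Real.log_lt_log ht h
  rw [gFun, Real.log_exp, lt_min_iff] at hlog
  rw [Set.mem_Icc, div_le_iff₀ hα.1, le_div_iff₀ (sub_pos.2 hα.2)]
  constructor <;> linarith [hlog.1, hlog.2]

theorem HasConcentrationBound.measureReal_lt_gFun_le {Ω : Type*} [MeasurableSpace Ω]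
    {P : Measure Ω} [IsFiniteMeasure P] {Y : Ω → ℝ} {B : ℝ} (hY : HasConcentrationBound Y P B)
    {α t : ℝ} (hα : α ∈ Set.Ioo (0 : ℝ) 1) (ht : t ∈ Set.Ioc (0 : ℝ) 1) :
    P.real {w | t < gFun α (Y w)} ≤ B * (-Real.log t * ((1 - α) * α)⁻¹ + 1) := by
  have h1α : 0 < 1 - α := sub_pos.2 hα.2
  have h0α : 0 < α := hα.1
  have hlog : Real.log t ≤ 0 := Real.log_nonpos ht.1.le ht.2
  have hle : Real.log t / α ≤ -Real.log t / (1 - α) :=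
    (div_nonpos_of_nonpos_of_nonneg hlog h0α.le).trans (div_nonneg (by linarith) h1α.le)
  calc P.real {w | t < gFun α (Y w)}
      ≤ P.real (Y ⁻¹' Set.Icc (Real.log t / α) (-Real.log t / (1 - α))) :=
        measureReal_mono fun w hw => mem_Icc_of_lt_gFun hα ht.1 hw
    _ ≤ B * (-Real.log t / (1 - α) - Real.log t / α + 1) := hY _ _ hle
    _ = B * (-Real.log t * ((1 - α) * α)⁻¹ + 1) := by
        field_simp
        ring

theorem integrableOn_neg_log_mul_add_one (c : ℝ) :
    IntegrableOn (fun t => -Real.log t * c + 1) (Set.Ioc 0 1) :=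
  ((((intervalIntegrable_iff_integrableOn_Ioc_of_le zero_le_one).1
    intervalIntegral.intervalIntegrable_log').neg.mul_const c).add (integrableOn_const (by simp)))

theorem integral_neg_log_mul_add_one (c : ℝ) :
    ∫ t in Set.Ioc (0 : ℝ) 1, (-Real.log t * c + 1) = c + 1 := by
  have hlog : IntervalIntegrable (fun t => -Real.log t * c) volume 0 1 :=
    intervalIntegral.intervalIntegrable_log'.neg.mul_const c
  rw [← intervalIntegral.integral_of_le zero_le_one,
    intervalIntegral.integral_add hlog intervalIntegrable_const,
    intervalIntegral.integral_mul_const, intervalIntegral.integral_neg, integral_log]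
  simp

theorem HasConcentrationBound.integral_gFun_le {Ω : Type*} [MeasurableSpace Ω] {P : Measure Ω}
    [IsFiniteMeasure P] {Y : Ω → ℝ} {B : ℝ} (hYB : HasConcentrationBound Y P B)
    (hY : AEMeasurable Y P) {α : ℝ} (hα : α ∈ Set.Ioo (0 : ℝ) 1) :
    ∫ w, gFun α (Y w) ∂P ≤ B * (((1 - α) * α)⁻¹ + 1) := by
  have hα' := Set.Ioo_subset_Icc_self hα
  set F : ℝ → ℝ :=
    (Set.Ioc (0 : ℝ) 1).indicator fun t => B * (-Real.log t * ((1 - α) * α)⁻¹ + 1)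
  have hF : Integrable F := (integrable_indicator_iff measurableSet_Ioc).2
    ((integrableOn_neg_log_mul_add_one _).const_mul B)
  have hle (t : ℝ) (ht : t ∈ Set.Ioi (0 : ℝ)) : P.real {w | t < gFun α (Y w)} ≤ F t := by
    rcases le_or_gt t 1 with ht1 | ht1
    · simp only [F, Set.indicator_of_mem (show t ∈ Set.Ioc (0 : ℝ) 1 from ⟨ht, ht1⟩)]
      exact hYB.measureReal_lt_gFun_le hα ⟨ht, ht1⟩
    · have hempty : {w | t < gFun α (Y w)} = ∅ :=
        Set.eq_empty_of_forall_notMem fun w hw => (hw.trans_le (gFun_le_one hα' _)).not_gt ht1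
      rw [hempty, measureReal_empty]
      exact (Set.indicator_of_notMem (fun h => ht1.not_ge h.2) _).ge
  calc ∫ w, gFun α (Y w) ∂P = ∫ t in Set.Ioi (0 : ℝ), P.real {w | t < gFun α (Y w)} :=
        (integrable_gFun_comp hY hα').integral_eq_integral_meas_lt
          (.of_forall fun w => gFun_nonneg _ _)
    _ ≤ ∫ t in Set.Ioi (0 : ℝ), F t :=
        integral_mono_of_nonneg (.of_forall fun t => measureReal_nonneg) hF.integrableOn
          ((ae_restrict_iff' measurableSet_Ioi).2 (.of_forall hle))
    _ = B * (((1 - α) * α)⁻¹ + 1) := by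
        rw [setIntegral_indicator measurableSet_Ioc,
          Set.inter_eq_self_of_subset_right Set.Ioc_subset_Ioi_self, integral_const_mul,
          integral_neg_log_mul_add_one]

/-- `gFun α` decays at rate `α` on the left of the origin and at rate `1 - α` on the right; the
interval around `x₀` lies on the side of the slower decay. -/
theorem exists_abs_eq_forall_exp_neg_le_gFun {α b : ℝ} (hα : α ∈ Set.Ioo (0 : ℝ) 1)
    (hb : 0 ≤ b) : ∃ x₀ : ℝ, |x₀| = b / ((1 - α) * α) ∧
      ∀ x, |x - x₀| ≤ b / ((1 - α) * α) → Real.exp (-(4 * b)) ≤ gFun α x := by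
  have h1α : 0 < 1 - α := sub_pos.2 hα.2
  have h0α : 0 < α := hα.1
  set c := b / ((1 - α) * α) with hcdef
  have hc : 0 ≤ c := by positivity
  have hcb : (1 - α) * α * c = b := by
    rw [hcdef]
    field_simp
  rcases le_total α (1 / 2) with hα2 | hα2
  · have hαc : α * c ≤ 2 * b := by nlinarith [mul_nonneg h0α.le hc]
    refine ⟨-c, by rw [abs_neg, abs_of_nonneg hc], fun x hx => ?_⟩
    obtain ⟨hx₁, hx₂⟩ := abs_le.1 hx
    exact Real.exp_le_exp.2 (le_min (by nlinarith) (by nlinarith))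
  · have hαc : (1 - α) * c ≤ 2 * b := by nlinarith [mul_nonneg h1α.le hc]
    refine ⟨c, abs_of_nonneg hc, fun x hx => ?_⟩
    obtain ⟨hx₁, hx₂⟩ := abs_le.1 hx
    exact Real.exp_le_exp.2 (le_min (by nlinarith) (by nlinarith))

namespace IsCenteredFamily

variable {ι Ω : Type*} [MeasurableSpace Ω] {P : Measure Ω} [IsProbabilityMeasure P]
  {X : ι → Ω → ℝ} {K : ℝ}

theorem integral_gFun_sum_le (h : IsCenteredFamily X P) (s : Finset ι) (hK : 1 ≤ K)
    (hV : 0 < Var[∑ i ∈ s, X i; P])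
    (h3 : ∑ i ∈ s, ∫ w, |X i w| ^ 3 ∂P ≤ 2 * K * Var[∑ i ∈ s, X i; P]) {α : ℝ}
    (hα : α ∈ Set.Ioo (0 : ℝ) 1) :
    ∫ w, gFun α ((∑ i ∈ s, X i) w) ∂P ≤
      10 * K ^ 2 / (√Var[∑ i ∈ s, X i; P] * (1 - α) * α) := by
  have := Real.sqrt_pos.2 hV
  have hq : 0 < (1 - α) * α := mul_pos (sub_pos.2 hα.2) hα.1
  have hq4 : 1 ≤ ((1 - α) * α)⁻¹ / 4 := by
    rw [le_div_iff₀ (by norm_num), le_inv_comm₀ (by norm_num) hq]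
    nlinarith [sq_nonneg (α - 1 / 2)]
  calc ∫ w, gFun α ((∑ i ∈ s, X i) w) ∂P
      ≤ 8 * K ^ 2 / √Var[∑ i ∈ s, X i; P] * (((1 - α) * α)⁻¹ + 1) :=
        (h.hasConcentrationBound_sum s hK hV h3).integral_gFun_le
          (h.measurable_sum s).aemeasurable hα
    _ ≤ 8 * K ^ 2 / √Var[∑ i ∈ s, X i; P] * (((1 - α) * α)⁻¹ + ((1 - α) * α)⁻¹ / 4) := by gcongr
    _ = 10 * K ^ 2 / (√Var[∑ i ∈ s, X i; P] * (1 - α) * α) := by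
        rw [mul_assoc √_]
        field_simp
        norm_num

theorem le_integral_gFun_sum (h : IsCenteredFamily X P) (s : Finset ι) (hK : 1 ≤ K)
    (h3 : ∑ i ∈ s, ∫ w, |X i w| ^ 3 ∂P ≤ K * Var[∑ i ∈ s, X i; P]) {M α : ℝ}
    (hM : 163840 * K ^ 5 ≤ M) (hα : α ∈ Set.Ioo (0 : ℝ) 1)
    (hV : 1536 * K ^ 2 * M ≤ √Var[∑ i ∈ s, X i; P] * (1 - α) * α) :
    Real.exp (-(8 * M)) * (M / (1024 * K ^ 2)) / (√Var[∑ i ∈ s, X i; P] * (1 - α) * α) ≤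
      ∫ w, gFun α ((∑ i ∈ s, X i) w) ∂P := by
  have hM0 : 0 < M := lt_of_lt_of_le (by positivity) hM
  have hq : 0 < (1 - α) * α := mul_pos (sub_pos.2 hα.2) hα.1
  have hq1 : (1 - α) * α ≤ 1 := by nlinarith [hα.1, hα.2]
  obtain ⟨x₀, hx₀, hgFun⟩ :=
    exists_abs_eq_forall_exp_neg_le_gFun hα (by linarith : 0 ≤ 2 * M)
  set r := √Var[∑ i ∈ s, X i; P]
  set a := M / ((1 - α) * α) with ha
  have hda : 2 * M / ((1 - α) * α) = 2 * a := mul_div_assoc _ _ _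
  rw [hda, show 4 * (2 * M) = 8 * M by ring] at hgFun
  rw [hda] at hx₀
  have hMa : M ≤ a := le_div_self hM0.le hq hq1
  have har : |x₀| + a ≤ r / (512 * K ^ 2) := by
    rw [hx₀, le_div_iff₀ (by positivity), ha]
    calc (2 * (M / ((1 - α) * α)) + M / ((1 - α) * α)) * (512 * K ^ 2)
        = 1536 * K ^ 2 * M / ((1 - α) * α) := by ring
      _ ≤ r := (div_le_iff₀ hq).2 (by linarith)
  calc Real.exp (-(8 * M)) * (M / (1024 * K ^ 2)) / (r * (1 - α) * α)
      = Real.exp (-(8 * M)) * (a / (1024 * K ^ 2 * r)) := by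
        rw [ha, mul_assoc r]
        field_simp
    _ ≤ Real.exp (-(8 * M)) * P.real {w | |(∑ i ∈ s, X i) w - x₀| ≤ 2 * a} := by
        gcongr
        exact h.le_measureReal_abs_sum_sub_le s hK h3 (hM.trans hMa) har
    _ ≤ Real.exp (-(8 * M)) *
          P.real {w | Real.exp (-(8 * M)) ≤ gFun α ((∑ i ∈ s, X i) w)} :=
        mul_le_mul_of_nonneg_left (measureReal_mono fun w hw => hgFun _ hw) (Real.exp_pos _).le
    _ ≤ ∫ w, gFun α ((∑ i ∈ s, X i) w) ∂P :=
        mul_meas_ge_le_integral_of_nonneg (.of_forall fun w => gFun_nonneg _ _)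
          (integrable_gFun_comp (h.measurable_sum s).aemeasurable (Set.Ioo_subset_Icc_self hα)) _

end IsCenteredFamily

/-! ### Moment generating functions and their minimizers -/

section MomentGenerating

theorem existsUnique_mem_Ioo_isMinOn {φ : ℝ → ℝ} {a b : ℝ} (hab : a < b)
    (hc : ContinuousOn φ (Set.Icc a b)) (hφ : StrictConvexOn ℝ (Set.Icc a b) φ) (h : φ a = φ b) :
    ∃! t, t ∈ Set.Ioo a b ∧ IsMinOn φ (Set.Ioo a b) t := by
  have ha := Set.left_mem_Icc.2 hab.le
  have hb := Set.right_mem_Icc.2 hab.le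
  obtain ⟨t, ht, hmin | hmax⟩ := exists_Ioo_extr_on_Icc hab hc h
  · have hmin' : IsMinOn φ (Set.Ioo a b) t := IsMinOn.on_subset hmin Set.Ioo_subset_Icc_self
    exact ⟨t, ⟨ht, hmin'⟩, fun s hs => (hφ.subset Set.Ioo_subset_Icc_self
      (convex_Ioo a b)).eq_of_isMinOn hs.2 hmin' hs.1 ht⟩
  · have hlt : φ t < max (φ a) (φ b) :=
      hφ.lt_on_openSegment ha hb hab.ne (by rwa [openSegment_eq_Ioo hab])
    rw [← h, max_self] at hlt
    exact absurd (hmax ha) hlt.not_ge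

variable {Ω : Type*} [MeasurableSpace Ω] {P : Measure Ω} {X : Ω → ℝ}

theorem strictConvexOn_mgf (hX : ¬ X =ᵐ[P] 0) :
    StrictConvexOn ℝ (integrableExpSet X P) (mgf X P) := by
  refine ⟨convex_integrableExpSet, fun a ha b hb hab s t hs ht hst => ?_⟩
  have hm : Integrable (fun w => Real.exp ((s * a + t * b) * X w)) P :=
    convex_integrableExpSet ha hb hs.le ht.le hst
  have hsum : Integrable (fun w => s * Real.exp (a * X w) + t * Real.exp (b * X w)) P :=
    (ha.const_mul s).add (hb.const_mul t)
  have hsplit : ∀ w, (s * a + t * b) * X w = s • (a * X w) + t • (b * X w) := fun w => by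
    simp only [smul_eq_mul]; ring
  have hgap : ∀ w, X w ≠ 0 → Real.exp ((s * a + t * b) * X w) <
      s * Real.exp (a * X w) + t * Real.exp (b * X w) := fun w hw => by
    rw [hsplit]
    exact strictConvexOn_exp.2 (Set.mem_univ _) (Set.mem_univ _)
      (fun h => hab (mul_right_cancel₀ hw h)) hs ht hst
  have hle : ∀ w, Real.exp ((s * a + t * b) * X w) ≤
      s * Real.exp (a * X w) + t * Real.exp (b * X w) := fun w => by
    rw [hsplit]
    exact convexOn_exp.2 (Set.mem_univ _) (Set.mem_univ _) hs.le ht.le hst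
  have hpos : 0 < ∫ w, (s * Real.exp (a * X w) + t * Real.exp (b * X w) -
      Real.exp ((s * a + t * b) * X w)) ∂P := by
    rw [integral_pos_iff_support_of_nonneg (fun w => sub_nonneg.2 (hle w)) (hsum.sub hm)]
    refine (pos_iff_ne_zero.2 (mt ae_iff.2 hX)).trans_le (measure_mono fun w hw => ?_)
    exact (sub_pos.2 (hgap w hw)).ne'
  rw [integral_sub hsum hm, integral_add (ha.const_mul s) (hb.const_mul t), integral_const_mul,
    integral_const_mul] at hpos
  exact sub_pos.1 hpos

theorem continuousOn_mgf_Icc {a b : ℝ} (ha : a ∈ integrableExpSet X P)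
    (hb : b ∈ integrableExpSet X P) : ContinuousOn (mgf X P) (Set.Icc a b) := by
  refine continuousOn_of_dominated (bound := fun w => Real.exp (a * X w) + Real.exp (b * X w))
    (fun t ht => (integrable_exp_mul_of_le_of_le ha hb ht.1 ht.2).aestronglyMeasurable)
    (fun t ht => .of_forall fun w => ?_) (ha.add hb) (.of_forall fun w => by fun_prop)
  rw [Real.norm_of_nonneg (Real.exp_nonneg _)]
  rcases le_total 0 (X w) with hw | hw
  · have : t * X w ≤ b * X w := mul_le_mul_of_nonneg_right ht.2 hw
    linarith [Real.exp_le_exp.2 this, Real.exp_nonneg (a * X w)]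
  · have : t * X w ≤ a * X w := mul_le_mul_of_nonpos_right ht.1 hw
    linarith [Real.exp_le_exp.2 this, Real.exp_nonneg (b * X w)]

end MomentGenerating

/-! ### Pairs of densities and exponential tilting -/

section Density

theorem logRatio_swap {𝒳 : Type u} (f g : 𝒳 → ℝ) : logRatio g f = -logRatio f g := by
  ext x
  rw [Pi.neg_apply, logRatio, logRatio, ← inv_div, Real.log_inv]

variable {𝒳 : Type u} [MeasurableSpace 𝒳] {ν : Measure 𝒳} {f g : 𝒳 → ℝ}

theorem IsDensity.integrable (hf : IsDensity ν f) : Integrable f ν :=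
  .of_integral_ne_zero (hf.integral_eq_one ▸ one_ne_zero)

theorem IsDensity.isProbabilityMeasure (hf : IsDensity ν f) :
    IsProbabilityMeasure (densityMeasure ν f) := by
  refine ⟨?_⟩
  rw [densityMeasure, withDensity_apply _ MeasurableSet.univ, Measure.restrict_univ,
    ← ofReal_integral_eq_lintegral_ofReal hf.integrable (.of_forall hf.nonneg), hf.integral_eq_one,
    ENNReal.ofReal_one]

theorem integral_densityMeasure (hf : Measurable f) (hf0 : ∀ x, 0 ≤ f x) (h : 𝒳 → ℝ) :
    ∫ x, h x ∂(densityMeasure ν f) = ∫ x, f x * h x ∂ν := by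
  rw [densityMeasure, integral_withDensity_eq_integral_toReal_smul hf.ennreal_ofReal
    (.of_forall fun x => ENNReal.ofReal_lt_top)]
  simp only [ENNReal.toReal_ofReal (hf0 _), smul_eq_mul]

theorem integrable_densityMeasure_iff (hf : Measurable f) (hf0 : ∀ x, 0 ≤ f x) {h : 𝒳 → ℝ} :
    Integrable h (densityMeasure ν f) ↔ Integrable (fun x => f x * h x) ν := by
  rw [densityMeasure, integrable_withDensity_iff_integrable_smul' hf.ennreal_ofReal
    (.of_forall fun x => ENNReal.ofReal_lt_top)]
  simp only [ENNReal.toReal_ofReal (hf0 _), smul_eq_mul]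

theorem ae_densityMeasure_iff (hf : Measurable f) {p : 𝒳 → Prop} :
    (∀ᵐ x ∂(densityMeasure ν f), p x) ↔ ∀ᵐ x ∂ν, 0 < f x → p x := by
  rw [densityMeasure, ae_withDensity_iff hf.ennreal_ofReal]
  simp only [ne_eq, ENNReal.ofReal_eq_zero, not_le]

theorem measurable_logRatio (hf : Measurable f) (hg : Measurable g) : Measurable (logRatio f g) :=
  Real.measurable_log.comp (hf.div hg)

theorem measurable_centeredLogRatio (hf : Measurable f) (hg : Measurable g) (α : ℝ) :
    Measurable (centeredLogRatio ν f g α) :=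
  (measurable_logRatio hf hg).sub_const _

/-- A pair of probability densities with almost everywhere the same zero set, so that the two
distributions have the same null sets. -/
structure IsEquivDensityPair (ν : Measure 𝒳) (f g : 𝒳 → ℝ) : Prop where
  left : IsDensity ν f
  right : IsDensity ν g
  pos_iff : ∀ᵐ x ∂ν, 0 < f x ↔ 0 < g x

theorem isEquivDensityPair_of_absolutelyContinuous (hf : IsDensity ν f) (hg : IsDensity ν g)
    (hfg : densityMeasure ν f ≪ densityMeasure ν g)
    (hgf : densityMeasure ν g ≪ densityMeasure ν f) : IsEquivDensityPair ν f g := by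
  have hpos : ∀ {u v : 𝒳 → ℝ}, IsDensity ν u → IsDensity ν v →
      densityMeasure ν u ≪ densityMeasure ν v → ∀ᵐ x ∂ν, 0 < u x → 0 < v x := fun hu hv huv =>
    (ae_densityMeasure_iff hu.measurable).1
      (huv.ae_le ((ae_densityMeasure_iff hv.measurable).2 (.of_forall fun _ => id)))
  refine ⟨hf, hg, ?_⟩
  filter_upwards [hpos hf hg hfg, hpos hg hf hgf] with x h₁ h₂ using ⟨h₁, h₂⟩

namespace IsEquivDensityPair

variable {α : ℝ} (h : IsEquivDensityPair ν f g)
include h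

theorem ae_pos_or_eq_zero : ∀ᵐ x ∂ν, (0 < f x ∧ 0 < g x) ∨ (f x = 0 ∧ g x = 0) := by
  filter_upwards [h.pos_iff] with x hx
  rcases (h.left.nonneg x).eq_or_lt with h₀ | h₀
  · exact .inr ⟨h₀.symm, (not_lt.1 (mt hx.2 h₀.not_lt)).antisymm (h.right.nonneg x)⟩
  · exact .inl ⟨h₀, hx.1 h₀⟩

theorem ae_rpow_mul_rpow_eq (α : ℝ) :
    ∀ᵐ x ∂ν, f x ^ (1 - α) * g x ^ α = f x * Real.exp (α * logRatio g f x) := by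
  filter_upwards [h.ae_pos_or_eq_zero] with x hx
  rcases hx with ⟨hf, hg⟩ | ⟨hf, hg⟩
  · rw [logRatio, Real.log_div hg.ne' hf.ne', Real.rpow_sub hf, Real.rpow_one,
      Real.rpow_def_of_pos hg, Real.rpow_def_of_pos hf, div_mul_eq_mul_div, mul_div_assoc,
      ← Real.exp_sub]
    ring_nf
  · rw [hf, hg, zero_mul]
    rcases eq_or_ne α 0 with rfl | hα
    · simp
    · rw [Real.zero_rpow hα, mul_zero]

theorem mgf_logRatio (α : ℝ) : mgf (logRatio g f) (densityMeasure ν f) α =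
    ∫ x, f x ^ (1 - α) * g x ^ α ∂ν := by
  rw [mgf, integral_densityMeasure h.left.measurable h.left.nonneg]
  exact (integral_congr_ae (h.ae_rpow_mul_rpow_eq α)).symm

theorem mgf_logRatio_one : mgf (logRatio g f) (densityMeasure ν f) 1 = 1 := by
  rw [h.mgf_logRatio]
  simpa using h.right.integral_eq_one

theorem chernoffDiv_eq_neg_cgf :
    chernoffDiv ν f g = -cgf (logRatio g f) (densityMeasure ν f) := by
  ext α
  rw [chernoffDiv, Pi.neg_apply, cgf, h.mgf_logRatio]

theorem zero_mem_integrableExpSet :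
    0 ∈ integrableExpSet (logRatio g f) (densityMeasure ν f) := by
  have := h.left.isProbabilityMeasure
  simp [integrableExpSet]

theorem one_mem_integrableExpSet :
    1 ∈ integrableExpSet (logRatio g f) (densityMeasure ν f) := by
  refine (integrable_densityMeasure_iff h.left.measurable h.left.nonneg).2
    (h.right.integrable.congr ?_)
  filter_upwards [h.ae_rpow_mul_rpow_eq 1] with x hx
  simpa using hx

theorem Icc_subset_integrableExpSet :
    Set.Icc 0 1 ⊆ integrableExpSet (logRatio g f) (densityMeasure ν f) := fun _ hα =>
  integrable_exp_mul_of_le_of_le h.zero_mem_integrableExpSet h.one_mem_integrableExpSet hα.1 hα.2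

theorem mgf_logRatio_pos (hα : α ∈ Set.Icc (0 : ℝ) 1) :
    0 < mgf (logRatio g f) (densityMeasure ν f) α :=
  have := h.left.isProbabilityMeasure
  mgf_pos (h.Icc_subset_integrableExpSet hα)

theorem mem_interior_integrableExpSet (hα : α ∈ Set.Ioo (0 : ℝ) 1) :
    α ∈ interior (integrableExpSet (logRatio g f) (densityMeasure ν f)) :=
  interior_mono h.Icc_subset_integrableExpSet (by rwa [interior_Icc])

theorem exp_neg_chernoffDiv (hα : α ∈ Set.Icc (0 : ℝ) 1) :
    Real.exp (-chernoffDiv ν f g α) = mgf (logRatio g f) (densityMeasure ν f) α := by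
  rw [h.chernoffDiv_eq_neg_cgf, Pi.neg_apply, neg_neg, cgf, Real.exp_log (h.mgf_logRatio_pos hα)]

theorem chernoffMeasure_eq_tilted (hα : α ∈ Set.Icc (0 : ℝ) 1) : chernoffMeasure ν f g α =
    (densityMeasure ν f).tilted fun x => α * logRatio g f x := by
  have hL := measurable_logRatio h.right.measurable h.left.measurable
  rw [Measure.tilted, ← mgf, ← h.exp_neg_chernoffDiv hα, densityMeasure,
    ← withDensity_mul _ h.left.measurable.ennreal_ofReal (by fun_prop), chernoffMeasure,
    densityMeasure]
  refine withDensity_congr_ae ?_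
  filter_upwards [h.ae_rpow_mul_rpow_eq α] with x hx
  rw [Pi.mul_apply, ← ENNReal.ofReal_mul (h.left.nonneg x), ← mul_div_assoc, hx, Real.exp_neg,
    div_inv_eq_mul]

theorem ae_chernoffMeasure_pos (hα : α ∈ Set.Icc (0 : ℝ) 1) :
    ∀ᵐ x ∂(chernoffMeasure ν f g α), 0 < f x ∧ 0 < g x := by
  rw [h.chernoffMeasure_eq_tilted hα]
  refine (tilted_absolutelyContinuous _ _).ae_le ((ae_densityMeasure_iff h.left.measurable).2 ?_)
  filter_upwards [h.pos_iff] with x hx hf using ⟨hf, hx.1 hf⟩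

theorem isDensity_chernoff (hα : α ∈ Set.Icc (0 : ℝ) 1) :
    IsDensity ν fun x => f x ^ (1 - α) * g x ^ α * Real.exp (chernoffDiv ν f g α) where
  measurable := ((h.left.measurable.pow_const _).mul (h.right.measurable.pow_const _)).mul_const _
  nonneg x := mul_nonneg (mul_nonneg (Real.rpow_nonneg (h.left.nonneg x) _)
    (Real.rpow_nonneg (h.right.nonneg x) _)) (Real.exp_nonneg _)
  integral_eq_one := by
    rw [integral_mul_const, ← h.mgf_logRatio, ← h.exp_neg_chernoffDiv hα, ← Real.exp_add,
      neg_add_cancel, Real.exp_zero]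

theorem isProbabilityMeasure_chernoffMeasure (hα : α ∈ Set.Icc (0 : ℝ) 1) :
    IsProbabilityMeasure (chernoffMeasure ν f g α) :=
  (h.isDensity_chernoff hα).isProbabilityMeasure

theorem memLp_logRatio (hα : α ∈ Set.Ioo (0 : ℝ) 1) (p : NNReal) :
    MemLp (logRatio f g) p (chernoffMeasure ν f g α) := by
  rw [h.chernoffMeasure_eq_tilted (Set.Ioo_subset_Icc_self hα), logRatio_swap g f]
  exact (memLp_tilted_mul (h.mem_interior_integrableExpSet hα) p).neg

theorem integral_logRatio (hα : α ∈ Set.Ioo (0 : ℝ) 1) :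
    ∫ x, logRatio f g x ∂(chernoffMeasure ν f g α) = deriv (chernoffDiv ν f g) α := by
  rw [logRatio_swap g f, integral_neg', h.chernoffDiv_eq_neg_cgf, deriv.neg,
    h.chernoffMeasure_eq_tilted (Set.Ioo_subset_Icc_self hα),
    integral_tilted_mul_self (h.mem_interior_integrableExpSet hα)]

theorem varZ_eq_neg_iteratedDeriv (hα : α ∈ Set.Ioo (0 : ℝ) 1) :
    varZ ν f g α = -iteratedDeriv 2 (chernoffDiv ν f g) α := by
  have := h.isProbabilityMeasure_chernoffMeasure (Set.Ioo_subset_Icc_self hα)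
  have hL := (measurable_logRatio h.left.measurable h.right.measurable).aestronglyMeasurable
    (μ := chernoffMeasure ν f g α)
  rw [varZ, show centeredLogRatio ν f g α = fun x => logRatio f g x - _ from rfl,
    variance_sub_const hL, logRatio_swap g f, variance_neg, h.chernoffDiv_eq_neg_cgf,
    iteratedDeriv_neg, neg_neg, h.chernoffMeasure_eq_tilted (Set.Ioo_subset_Icc_self hα),
    variance_tilted_mul (h.mem_interior_integrableExpSet hα)]

theorem affinity_eq (hα : α ∈ Set.Icc (0 : ℝ) 1) :
    affinity ν f g = expectG ν f g α * Real.exp (-chernoffDiv ν f g α) := by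
  have hd := h.isDensity_chernoff hα
  rw [affinity, expectG, chernoffMeasure, integral_densityMeasure hd.measurable hd.nonneg,
    ← integral_mul_const]
  refine integral_congr_ae ?_
  filter_upwards [h.ae_pos_or_eq_zero, h.ae_rpow_mul_rpow_eq α] with x hx hweight
  have hcancel : ∀ a b : ℝ, a * Real.exp (chernoffDiv ν f g α) * b *
      Real.exp (-chernoffDiv ν f g α) = a * b := fun a b => by
    rw [mul_right_comm a, mul_assoc _ (Real.exp _), ← Real.exp_add, add_neg_cancel, Real.exp_zero,
      mul_one]
  rw [hcancel, hweight]
  rcases hx with ⟨hfx, hgx⟩ | ⟨hfx, hgx⟩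
  · have hexp : Real.exp (logRatio g f x) = g x / f x := Real.exp_log (div_pos hgx hfx)
    calc min (f x) (g x) = f x * min 1 (Real.exp (logRatio g f x)) := by
          rw [hexp, mul_min_of_nonneg _ _ hfx.le, mul_one, mul_div_cancel₀ _ hfx.ne']
      _ = f x * Real.exp (min 0 (logRatio g f x)) := by
          rw [Real.exp_monotone.map_min, Real.exp_zero]
      _ = f x * Real.exp (α * logRatio g f x) * gFun α (logRatio f g x) := by
          rw [gFun, mul_assoc, ← Real.exp_add, ← min_add_add_left, logRatio_swap f g, Pi.neg_apply]
          ring_nf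
  · rw [hfx, hgx, min_self, zero_mul, zero_mul]

theorem affinity_le_mul_exp_iff (hα : α ∈ Set.Icc (0 : ℝ) 1) {B : ℝ} :
    affinity ν f g ≤ B * Real.exp (-chernoffDiv ν f g α) ↔ expectG ν f g α ≤ B := by
  rw [h.affinity_eq hα, mul_le_mul_iff_of_pos_right (Real.exp_pos _)]

theorem mul_exp_le_affinity_iff (hα : α ∈ Set.Icc (0 : ℝ) 1) {B : ℝ} :
    B * Real.exp (-chernoffDiv ν f g α) ≤ affinity ν f g ↔ B ≤ expectG ν f g α := by
  rw [h.affinity_eq hα, mul_le_mul_iff_of_pos_right (Real.exp_pos _)]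

theorem ae_eq_of_logRatio_ae_eq_zero (hL : logRatio g f =ᵐ[densityMeasure ν f] 0) :
    f =ᵐ[ν] g := by
  filter_upwards [(ae_densityMeasure_iff h.left.measurable).1 hL, h.ae_pos_or_eq_zero]
    with x hx hpos
  rcases hpos with ⟨hf, hg⟩ | ⟨hf, hg⟩
  · have hlog : logRatio g f x = 0 := hx hf
    rw [logRatio, Real.log_div hg.ne' hf.ne', sub_eq_zero] at hlog
    exact (Real.log_injOn_pos hg hf hlog).symm
  · rw [hf, hg]

theorem isChernoffPoint_iff : IsChernoffPoint ν f g α ↔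
    α ∈ Set.Ioo 0 1 ∧ IsMinOn (mgf (logRatio g f) (densityMeasure ν f)) (Set.Ioo 0 1) α := by
  refine and_congr_right fun hα => forall₂_congr fun β hβ => ?_
  have hαβ := Real.log_le_log_iff (h.mgf_logRatio_pos (Set.Ioo_subset_Icc_self hα))
    (h.mgf_logRatio_pos (Set.Ioo_subset_Icc_self hβ))
  rw [h.chernoffDiv_eq_neg_cgf]
  exact neg_le_neg_iff.trans hαβ

theorem existsUnique_isChernoffPoint (hne : ¬ f =ᵐ[ν] g) : ∃! α, IsChernoffPoint ν f g α := by
  have := h.left.isProbabilityMeasure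
  simp_rw [h.isChernoffPoint_iff]
  refine existsUnique_mem_Ioo_isMinOn zero_lt_one
    (continuousOn_mgf_Icc h.zero_mem_integrableExpSet h.one_mem_integrableExpSet)
    ((strictConvexOn_mgf (mt h.ae_eq_of_logRatio_ae_eq_zero hne)).subset
      h.Icc_subset_integrableExpSet (convex_Icc 0 1)) ?_
  rw [mgf_zero, h.mgf_logRatio_one]

theorem integral_logRatio_eq_zero (hα : IsChernoffPoint ν f g α) :
    ∫ x, logRatio f g x ∂(chernoffMeasure ν f g α) = 0 := by
  rw [h.integral_logRatio hα.1]
  exact (hα.2.isLocalMax (Ioo_mem_nhds hα.1.1 hα.1.2)).deriv_eq_zero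

theorem memLp_centeredLogRatio (hα : α ∈ Set.Ioo (0 : ℝ) 1) (p : NNReal) :
    MemLp (centeredLogRatio ν f g α) p (chernoffMeasure ν f g α) :=
  have := h.isProbabilityMeasure_chernoffMeasure (Set.Ioo_subset_Icc_self hα)
  (h.memLp_logRatio hα p).sub (memLp_const _)

theorem integral_centeredLogRatio (hα : α ∈ Set.Ioo (0 : ℝ) 1) :
    ∫ x, centeredLogRatio ν f g α x ∂(chernoffMeasure ν f g α) = 0 := by
  have := h.isProbabilityMeasure_chernoffMeasure (Set.Ioo_subset_Icc_self hα)
  have hint : Integrable (logRatio f g) (chernoffMeasure ν f g α) :=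
    memLp_one_iff_integrable.1 (h.memLp_logRatio hα 1)
  simp only [centeredLogRatio]
  rw [integral_sub hint (integrable_const _), integral_const, probReal_univ, one_smul, sub_self]

theorem varZ_pos (hα : α ∈ Set.Ioo (0 : ℝ) 1) (hne : ¬ f =ᵐ[ν] g) : 0 < varZ ν f g α := by
  have hα' := Set.Ioo_subset_Icc_self hα
  have := h.isProbabilityMeasure_chernoffMeasure hα'
  have := h.left.isProbabilityMeasure
  refine (variance_nonneg _ _).lt_of_ne' fun hzero => hne (h.ae_eq_of_logRatio_ae_eq_zero ?_)
  have hconst := ae_eq_integral_of_variance_eq_zero (h.memLp_centeredLogRatio hα 2) hzero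
  rw [h.integral_centeredLogRatio hα, h.chernoffMeasure_eq_tilted hα'] at hconst
  obtain ⟨c, hL⟩ : ∃ c, ∀ᵐ x ∂(densityMeasure ν f), logRatio g f x = c := by
    refine ⟨-∫ x, logRatio f g x ∂(chernoffMeasure ν f g α), ?_⟩
    filter_upwards [absolutelyContinuous_tilted (h.Icc_subset_integrableExpSet hα') hconst]
      with x hx
    rw [logRatio_swap f g, Pi.neg_apply, sub_eq_zero.1 hx]
  have hc : Real.exp c = 1 := by
    have hexp : ∀ᵐ x ∂(densityMeasure ν f), Real.exp (1 * logRatio g f x) = Real.exp c :=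
      hL.mono fun x hx => by rw [hx, one_mul]
    rw [← h.mgf_logRatio_one, mgf, integral_congr_ae hexp, integral_const, probReal_univ, one_smul]
  filter_upwards [hL] with x hx
  rw [hx, (Real.exp_eq_one_iff c).1 hc, Pi.zero_apply]

end IsEquivDensityPair

end Density

/-! ### Product densities -/

section Product

theorem prodDensity_pos_iff {n : ℕ} {Ω : Fin n → Type u} {φ : ∀ j, Ω j → ℝ}
    (h : ∀ j x, 0 ≤ φ j x) (x : ∀ j, Ω j) : 0 < prodDensity φ x ↔ ∀ j, 0 < φ j (x j) := by
  have hx : 0 ≤ prodDensity φ x := Finset.prod_nonneg fun j _ => h j _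
  simp only [hx.lt_iff_ne', (h _ _).lt_iff_ne']
  simp only [prodDensity, Finset.prod_ne_zero_iff, Finset.mem_univ, true_imp_iff]

theorem rpow_mul_rpow_prodDensity {n : ℕ} {Ω : Fin n → Type u} {φ₀ φ₁ : ∀ j, Ω j → ℝ}
    (h₀ : ∀ j x, 0 ≤ φ₀ j x) (h₁ : ∀ j x, 0 ≤ φ₁ j x) (α : ℝ) (x : ∀ j, Ω j) :
    prodDensity φ₀ x ^ (1 - α) * prodDensity φ₁ x ^ α =
      prodDensity (fun j y => φ₀ j y ^ (1 - α) * φ₁ j y ^ α) x := by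
  simp only [prodDensity]
  rw [← Real.finsetProd_rpow _ _ fun j _ => h₀ j _, ← Real.finsetProd_rpow _ _ fun j _ => h₁ j _,
    Finset.prod_mul_distrib]

theorem logRatio_prodDensity {n : ℕ} {Ω : Fin n → Type u} {φ₀ φ₁ : ∀ j, Ω j → ℝ} {x : ∀ j, Ω j}
    (h₀ : ∀ j, φ₀ j (x j) ≠ 0) (h₁ : ∀ j, φ₁ j (x j) ≠ 0) :
    logRatio (prodDensity φ₀) (prodDensity φ₁) x = ∑ j, logRatio (φ₀ j) (φ₁ j) (x j) := by
  simp only [logRatio, prodDensity]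
  rw [← Finset.prod_div_distrib, Real.log_prod fun j _ => div_ne_zero (h₀ j) (h₁ j)]

variable {n : ℕ} {Ω : Fin n → Type u} [∀ j, MeasurableSpace (Ω j)] {μ : ∀ j, Measure (Ω j)}
  {φ₀ φ₁ : ∀ j, Ω j → ℝ} {α : ℝ}

theorem sigmaBar_sq : sigmaBar μ φ₀ φ₁ α ^ 2 = 1 / n * ∑ j, varZ (μ j) (φ₀ j) (φ₁ j) α :=
  Real.sq_sqrt (mul_nonneg (by positivity) (Finset.sum_nonneg fun _ _ => variance_nonneg _ _))

theorem natCast_mul_sigmaBar_sq :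
    n * sigmaBar μ φ₀ φ₁ α ^ 2 = ∑ j, varZ (μ j) (φ₀ j) (φ₁ j) α := by
  rcases eq_or_ne n 0 with rfl | hn
  · simp
  · rw [sigmaBar_sq, one_div, mul_inv_cancel_left₀ (Nat.cast_ne_zero.2 hn)]

theorem sqrt_mul_sigmaBar :
    √n * sigmaBar μ φ₀ φ₁ α = √(∑ j, varZ (μ j) (φ₀ j) (φ₁ j) α) := by
  have hnonneg : 0 ≤ sigmaBar μ φ₀ φ₁ α := Real.sqrt_nonneg _
  rw [← natCast_mul_sigmaBar_sq, Real.sqrt_mul n.cast_nonneg, Real.sqrt_sq hnonneg]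

variable [∀ j, SigmaFinite (μ j)]

theorem isDensity_prodDensity {φ : ∀ j, Ω j → ℝ} (h : ∀ j, IsDensity (μ j) (φ j)) :
    IsDensity (Measure.pi μ) (prodDensity φ) where
  measurable := Finset.measurable_prod _ fun j _ => (h j).measurable.comp (measurable_pi_apply j)
  nonneg x := Finset.prod_nonneg fun j _ => (h j).nonneg _
  integral_eq_one := by
    unfold prodDensity
    rw [integral_fintype_prod_eq_prod]
    exact Finset.prod_eq_one fun j _ => (h j).integral_eq_one

theorem densityMeasure_prodDensity {φ : ∀ j, Ω j → ℝ} (h : ∀ j, IsDensity (μ j) (φ j)) :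
    densityMeasure (Measure.pi μ) (prodDensity φ) =
      Measure.pi fun j => densityMeasure (μ j) (φ j) := by
  have := fun j => (h j).isProbabilityMeasure
  refine (Measure.pi_eq fun s hs => ?_).symm
  rw [densityMeasure, withDensity_apply _ (MeasurableSet.univ_pi hs),
    ← ofReal_integral_eq_lintegral_ofReal (isDensity_prodDensity h).integrable.integrableOn
      (.of_forall (isDensity_prodDensity h).nonneg), Measure.restrict_pi_pi]
  unfold prodDensity
  rw [integral_fintype_prod_eq_prod, ENNReal.ofReal_prod_of_nonneg
    fun j _ => integral_nonneg (h j).nonneg]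
  refine Finset.prod_congr rfl fun j _ => ?_
  rw [densityMeasure, withDensity_apply _ (hs j),
    ofReal_integral_eq_lintegral_ofReal (h j).integrable.integrableOn (.of_forall (h j).nonneg)]

theorem map_eval_densityMeasure_prodDensity {φ : ∀ j, Ω j → ℝ} (h : ∀ j, IsDensity (μ j) (φ j))
    (j : Fin n) : (densityMeasure (Measure.pi μ) (prodDensity φ)).map (Function.eval j) =
      densityMeasure (μ j) (φ j) := by
  have := fun j => (h j).isProbabilityMeasure
  rw [densityMeasure_prodDensity h, (measurePreserving_eval _ j).map_eq]

theorem prodDensity_congr_ae {φ ψ : ∀ j, Ω j → ℝ} (h : ∀ j, φ j =ᵐ[μ j] ψ j) :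
    prodDensity φ =ᵐ[Measure.pi μ] prodDensity ψ :=
  (Measure.ae_eq_pi h).mono fun _ hx => congrArg (fun y : Fin n → ℝ => ∏ j, y j) hx

theorem IsTestingPair.isEquivDensityPair (h : IsTestingPair μ φ₀ φ₁) (j : Fin n) :
    IsEquivDensityPair (μ j) (φ₀ j) (φ₁ j) := by
  refine isEquivDensityPair_of_absolutelyContinuous (h.density_zero j) (h.density_one j) ?_ ?_ <;>
    rw [← map_eval_densityMeasure_prodDensity h.density_zero j,
      ← map_eval_densityMeasure_prodDensity h.density_one j]
  · exact (InformationTheory.klDiv_ne_top_iff.1 h.kl_zero_one_lt_top.ne).1.map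
      (measurable_pi_apply j)
  · exact (InformationTheory.klDiv_ne_top_iff.1 h.kl_one_zero_lt_top.ne).1.map
      (measurable_pi_apply j)

theorem IsTestingPair.not_ae_eq (h : IsTestingPair μ φ₀ φ₁) :
    ¬ prodDensity φ₀ =ᵐ[Measure.pi μ] prodDensity φ₁ := by
  intro heq
  have hmeasure : densityMeasure (Measure.pi μ) (prodDensity φ₀) =
      densityMeasure (Measure.pi μ) (prodDensity φ₁) :=
    withDensity_congr_ae (heq.mono fun x hx => by simp only [hx])
  have := (isDensity_prodDensity h.density_one).isProbabilityMeasure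
  have hpos := h.kl_zero_one_pos
  rw [hmeasure, InformationTheory.klDiv_self] at hpos
  exact lt_irrefl _ hpos

variable (h : ∀ j, IsEquivDensityPair (μ j) (φ₀ j) (φ₁ j))
include h

theorem isEquivDensityPair_prodDensity :
    IsEquivDensityPair (Measure.pi μ) (prodDensity φ₀) (prodDensity φ₁) where
  left := isDensity_prodDensity fun j => (h j).left
  right := isDensity_prodDensity fun j => (h j).right
  pos_iff := by
    have hcoord : ∀ᵐ x ∂(Measure.pi μ), ∀ j, 0 < φ₀ j (x j) ↔ 0 < φ₁ j (x j) :=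
      ae_all_iff.2 fun j => Measure.tendsto_eval_ae_ae.eventually (h j).pos_iff
    filter_upwards [hcoord] with x hx
    rw [prodDensity_pos_iff (fun j => (h j).left.nonneg),
      prodDensity_pos_iff (fun j => (h j).right.nonneg)]
    exact forall_congr' hx

theorem chernoffDiv_prodDensity (hα : α ∈ Set.Icc (0 : ℝ) 1) :
    chernoffDiv (Measure.pi μ) (prodDensity φ₀) (prodDensity φ₁) α =
      ∑ j, chernoffDiv (μ j) (φ₀ j) (φ₁ j) α := by
  have hpos : ∀ j, ∫ x, φ₀ j x ^ (1 - α) * φ₁ j x ^ α ∂(μ j) ≠ 0 := fun j =>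
    (h j).mgf_logRatio α ▸ ((h j).mgf_logRatio_pos hα).ne'
  simp only [chernoffDiv, Finset.sum_neg_distrib]
  rw [← Real.log_prod fun j _ => hpos j, ← integral_fintype_prod_eq_prod]
  simp_rw [rpow_mul_rpow_prodDensity (fun j => (h j).left.nonneg) (fun j => (h j).right.nonneg)]
  rfl

theorem chernoffMeasure_prodDensity (hα : α ∈ Set.Icc (0 : ℝ) 1) :
    chernoffMeasure (Measure.pi μ) (prodDensity φ₀) (prodDensity φ₁) α =
      Measure.pi fun j => chernoffMeasure (μ j) (φ₀ j) (φ₁ j) α := by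
  refine Eq.trans ?_ (densityMeasure_prodDensity fun j => (h j).isDensity_chernoff hα)
  rw [chernoffMeasure, chernoffDiv_prodDensity h hα]
  congr 1
  ext x
  rw [rpow_mul_rpow_prodDensity (fun j => (h j).left.nonneg) (fun j => (h j).right.nonneg)]
  simp only [prodDensity, Finset.prod_mul_distrib, Real.exp_sum]

theorem measurePreserving_eval_chernoffMeasure (hα : α ∈ Set.Icc (0 : ℝ) 1) (j : Fin n) :
    MeasurePreserving (Function.eval j)
      (chernoffMeasure (Measure.pi μ) (prodDensity φ₀) (prodDensity φ₁) α)
      (chernoffMeasure (μ j) (φ₀ j) (φ₁ j) α) := by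
  have := fun j => (h j).isProbabilityMeasure_chernoffMeasure hα
  rw [chernoffMeasure_prodDensity h hα]
  exact measurePreserving_eval _ j

theorem integral_eval_chernoffMeasure (hα : α ∈ Set.Icc (0 : ℝ) 1) (j : Fin n) {F : Ω j → ℝ}
    (hF : Measurable F) :
    ∫ x, F (x j) ∂(chernoffMeasure (Measure.pi μ) (prodDensity φ₀) (prodDensity φ₁) α) =
      ∫ y, F y ∂(chernoffMeasure (μ j) (φ₀ j) (φ₁ j) α) := by
  have heval := measurePreserving_eval_chernoffMeasure h hα j
  rw [← heval.map_eq, integral_map heval.aemeasurable hF.aestronglyMeasurable]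

theorem isCenteredFamily_centeredLogRatio (hα : α ∈ Set.Ioo (0 : ℝ) 1) :
    IsCenteredFamily (fun j (x : ∀ j, Ω j) => centeredLogRatio (μ j) (φ₀ j) (φ₁ j) α (x j))
      (chernoffMeasure (Measure.pi μ) (prodDensity φ₀) (prodDensity φ₁) α) := by
  have hα' := Set.Ioo_subset_Icc_self hα
  have := fun j => (h j).isProbabilityMeasure_chernoffMeasure hα'
  have hm := fun j => measurable_centeredLogRatio (ν := μ j) (h j).left.measurable
    (h j).right.measurable α
  have heval := measurePreserving_eval_chernoffMeasure h hα'
  refine ⟨fun j => (hm j).comp (measurable_pi_apply j), ?_,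
    fun j => ((h j).memLp_centeredLogRatio hα 3).comp_measurePreserving (heval j), fun j => ?_⟩
  · rw [chernoffMeasure_prodDensity h hα']
    exact iIndepFun_pi fun j => (hm j).aemeasurable
  · exact (integral_eval_chernoffMeasure h hα' j (hm j)).trans ((h j).integral_centeredLogRatio hα)

theorem variance_centeredLogRatio_eval (hα : α ∈ Set.Icc (0 : ℝ) 1) (j : Fin n) :
    Var[fun x : ∀ j, Ω j => centeredLogRatio (μ j) (φ₀ j) (φ₁ j) α (x j);
      chernoffMeasure (Measure.pi μ) (prodDensity φ₀) (prodDensity φ₁) α] =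
      varZ (μ j) (φ₀ j) (φ₁ j) α :=
  (measurePreserving_eval_chernoffMeasure h hα j).variance_fun_comp
    (measurable_centeredLogRatio (h j).left.measurable (h j).right.measurable α).aemeasurable

theorem integral_abs_centeredLogRatio_eval_pow_three (hα : α ∈ Set.Icc (0 : ℝ) 1) (j : Fin n) :
    ∫ x, |centeredLogRatio (μ j) (φ₀ j) (φ₁ j) α (x j)| ^ 3
      ∂(chernoffMeasure (Measure.pi μ) (prodDensity φ₀) (prodDensity φ₁) α) =
      absThirdMomentZ (μ j) (φ₀ j) (φ₁ j) α :=
  integral_eval_chernoffMeasure h hα j (F := fun y => |centeredLogRatio _ _ _ α y| ^ 3)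
    ((measurable_centeredLogRatio (h j).left.measurable (h j).right.measurable α).norm.pow_const 3)

theorem logRatio_prodDensity_ae_eq_sum
    (hα : IsChernoffPoint (Measure.pi μ) (prodDensity φ₀) (prodDensity φ₁) α) :
    logRatio (prodDensity φ₀) (prodDensity φ₁)
      =ᵐ[chernoffMeasure (Measure.pi μ) (prodDensity φ₀) (prodDensity φ₁) α]
      ∑ j, fun x => centeredLogRatio (μ j) (φ₀ j) (φ₁ j) α (x j) := by
  have hα' := Set.Ioo_subset_Icc_self hα.1
  have hprod := isEquivDensityPair_prodDensity h
  have hfam := isCenteredFamily_centeredLogRatio h hα.1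
  have := hprod.isProbabilityMeasure_chernoffMeasure hα'
  obtain ⟨c, hc⟩ : ∃ c, logRatio (prodDensity φ₀) (prodDensity φ₁)
      =ᵐ[chernoffMeasure (Measure.pi μ) (prodDensity φ₀) (prodDensity φ₁) α]
      fun x => (∑ j, fun x => centeredLogRatio (μ j) (φ₀ j) (φ₁ j) α (x j)) x + c := by
    refine ⟨∑ j, ∫ y, logRatio (φ₀ j) (φ₁ j) y ∂(chernoffMeasure (μ j) (φ₀ j) (φ₁ j) α), ?_⟩
    filter_upwards [hprod.ae_chernoffMeasure_pos hα'] with x hx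
    rw [logRatio_prodDensity
      (fun j => ((prodDensity_pos_iff (fun j => (h j).left.nonneg) x).1 hx.1 j).ne')
      (fun j => ((prodDensity_pos_iff (fun j => (h j).right.nonneg) x).1 hx.2 j).ne'),
      Finset.sum_apply, ← Finset.sum_add_distrib]
    simp only [centeredLogRatio, sub_add_cancel]
  have hc₀ : c = 0 := by
    have hmean := hprod.integral_logRatio_eq_zero hα
    rwa [integral_congr_ae hc, integral_add (hfam.integrable_sum Finset.univ)
      (integrable_const c), hfam.integral_sum, integral_const, probReal_univ, one_smul,
      zero_add] at hmean
  simpa only [hc₀, add_zero] using hc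

theorem expectG_prodDensity
    (hα : IsChernoffPoint (Measure.pi μ) (prodDensity φ₀) (prodDensity φ₁) α) :
    expectG (Measure.pi μ) (prodDensity φ₀) (prodDensity φ₁) α =
      ∫ x, gFun α ((∑ j, fun x : ∀ j, Ω j => centeredLogRatio (μ j) (φ₀ j) (φ₁ j) α (x j)) x)
        ∂(chernoffMeasure (Measure.pi μ) (prodDensity φ₀) (prodDensity φ₁) α) :=
  integral_congr_ae ((logRatio_prodDensity_ae_eq_sum h hα).fun_comp (gFun α))

theorem variance_sum_centeredLogRatio_eval (hα : α ∈ Set.Ioo (0 : ℝ) 1) :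
    Var[∑ j, fun x : ∀ j, Ω j => centeredLogRatio (μ j) (φ₀ j) (φ₁ j) α (x j);
      chernoffMeasure (Measure.pi μ) (prodDensity φ₀) (prodDensity φ₁) α] =
      ∑ j, varZ (μ j) (φ₀ j) (φ₁ j) α := by
  have hα' := Set.Ioo_subset_Icc_self hα
  have := (isEquivDensityPair_prodDensity h).isProbabilityMeasure_chernoffMeasure hα'
  rw [(isCenteredFamily_centeredLogRatio h hα).variance_sum]
  exact Finset.sum_congr rfl fun j _ => variance_centeredLogRatio_eval h hα' j

theorem sum_varZ_pos (hα : α ∈ Set.Ioo (0 : ℝ) 1)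
    (hne : ¬ prodDensity φ₀ =ᵐ[Measure.pi μ] prodDensity φ₁) :
    0 < ∑ j, varZ (μ j) (φ₀ j) (φ₁ j) α := by
  obtain ⟨j, hj⟩ := not_forall.1 (mt prodDensity_congr_ae hne)
  exact Finset.sum_pos' (fun j _ => variance_nonneg _ _)
    ⟨j, Finset.mem_univ j, (h j).varZ_pos hα hj⟩

theorem sigmaBar_pos (hα : α ∈ Set.Ioo (0 : ℝ) 1)
    (hne : ¬ prodDensity φ₀ =ᵐ[Measure.pi μ] prodDensity φ₁) : 0 < sigmaBar μ φ₀ φ₁ α := by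
  have hpos := Real.sqrt_pos.2 (sum_varZ_pos h hα hne)
  rw [← sqrt_mul_sigmaBar] at hpos
  exact pos_of_mul_pos_right hpos (Real.sqrt_nonneg _)

theorem expectG_prodDensity_le
    (hα : IsChernoffPoint (Measure.pi μ) (prodDensity φ₀) (prodDensity φ₁) α)
    (hne : ¬ prodDensity φ₀ =ᵐ[Measure.pi μ] prodDensity φ₁) {K : ℝ} (hK : 1 ≤ K)
    (h3 : ∑ j, absThirdMomentZ (μ j) (φ₀ j) (φ₁ j) α ≤ K * n * sigmaBar μ φ₀ φ₁ α ^ 2) :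
    expectG (Measure.pi μ) (prodDensity φ₀) (prodDensity φ₁) α ≤
      10 * K ^ 2 / (√n * sigmaBar μ φ₀ φ₁ α * (1 - α) * α) := by
  have hα' := Set.Ioo_subset_Icc_self hα.1
  have := (isEquivDensityPair_prodDensity h).isProbabilityMeasure_chernoffMeasure hα'
  have hvar := variance_sum_centeredLogRatio_eval h hα.1
  have hpos := sum_varZ_pos h hα.1 hne
  rw [mul_assoc, natCast_mul_sigmaBar_sq, ← hvar] at h3
  simp_rw [← integral_abs_centeredLogRatio_eval_pow_three h hα'] at h3
  rw [← hvar] at hpos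
  rw [expectG_prodDensity h hα, sqrt_mul_sigmaBar, ← hvar]
  refine (isCenteredFamily_centeredLogRatio h hα.1).integral_gFun_sum_le Finset.univ hK hpos
    (h3.trans ?_) hα.1
  gcongr
  linarith

theorem le_expectG_prodDensity
    (hα : IsChernoffPoint (Measure.pi μ) (prodDensity φ₀) (prodDensity φ₁) α) {K M : ℝ}
    (hK : 1 ≤ K) (hM : 163840 * K ^ 5 ≤ M)
    (h3 : ∑ j, absThirdMomentZ (μ j) (φ₀ j) (φ₁ j) α ≤ K * n * sigmaBar μ φ₀ φ₁ α ^ 2)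
    (hσ : 1536 * K ^ 2 * M ≤ √n * sigmaBar μ φ₀ φ₁ α * (1 - α) * α) :
    Real.exp (-(8 * M)) * (M / (1024 * K ^ 2)) / (√n * sigmaBar μ φ₀ φ₁ α * (1 - α) * α) ≤
      expectG (Measure.pi μ) (prodDensity φ₀) (prodDensity φ₁) α := by
  have hα' := Set.Ioo_subset_Icc_self hα.1
  have := (isEquivDensityPair_prodDensity h).isProbabilityMeasure_chernoffMeasure hα'
  have hvar := variance_sum_centeredLogRatio_eval h hα.1
  rw [mul_assoc, natCast_mul_sigmaBar_sq, ← hvar] at h3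
  simp_rw [← integral_abs_centeredLogRatio_eval_pow_three h hα'] at h3
  rw [sqrt_mul_sigmaBar, ← hvar] at hσ ⊢
  rw [expectG_prodDensity h hα]
  exact (isCenteredFamily_centeredLogRatio h hα.1).le_integral_gFun_sum Finset.univ hK h3 hM hα.1 hσ

end Product

/-! ### Exponential families -/

section ExponentialFamilies

theorem hessianForm_eq_fderiv_fderiv {d : ℕ} (A : EuclideanSpace ℝ (Fin d) → ℝ)
    (θ v : EuclideanSpace ℝ (Fin d)) : hessianForm A θ v = fderiv ℝ (fderiv ℝ A) θ v v := by
  have hv : v = ∑ i, v i • EuclideanSpace.single i (1 : ℝ) := by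
    simpa using ((EuclideanSpace.basisFun (Fin d) ℝ).sum_repr v).symm
  conv_rhs => rw [hv]
  simp only [hessianForm, dotProduct, Matrix.mulVec, hessianMatrix, Matrix.of_apply,
    iteratedFDeriv_two_apply, Matrix.cons_val_zero, Matrix.cons_val_one, map_sum, map_smul,
    _root_.sum_apply, _root_.smul_apply, smul_eq_mul, Finset.mul_sum]
  rw [Finset.sum_comm]
  exact Finset.sum_congr rfl fun i _ => Finset.sum_congr rfl fun k _ => by ring

theorem iteratedDeriv_two_comp_lineMap {E F : Type*} [NormedAddCommGroup E] [NormedSpace ℝ E]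
    [NormedAddCommGroup F] [NormedSpace ℝ F] {A : E → F} {x y : E} {t : ℝ}
    (hA : ContDiffAt ℝ 2 A (AffineMap.lineMap x y t)) :
    iteratedDeriv 2 (fun s : ℝ => A (AffineMap.lineMap x y s)) t =
      fderiv ℝ (fderiv ℝ A) (AffineMap.lineMap x y t) (y - x) (y - x) := by
  have hline : ∀ s : ℝ, HasDerivAt (AffineMap.lineMap x y) (y - x) s := fun s =>
    AffineMap.hasDerivAt_lineMap
  have hderiv : deriv (fun s : ℝ => A (AffineMap.lineMap x y s)) =ᶠ[nhds t]
      fun s => fderiv ℝ A (AffineMap.lineMap x y s) (y - x) := by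
    have hdiff : ∀ᶠ z in nhds (AffineMap.lineMap x y t), ContDiffAt ℝ 2 A z :=
      hA.eventually (by simp)
    filter_upwards [(hline t).continuousAt.eventually hdiff] with s hs
    exact ((hs.differentiableAt (by simp)).hasFDerivAt.comp_hasDerivAt s (hline s)).deriv
  have hfderiv : DifferentiableAt ℝ (fderiv ℝ A) (AffineMap.lineMap x y t) :=
    (hA.fderiv_right (m := 1) (by norm_num)).differentiableAt (by simp)
  rw [iteratedDeriv_succ, iteratedDeriv_one, hderiv.deriv_eq]
  have hcomp := hfderiv.hasFDerivAt.comp_hasDerivAt t (hline t)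
  simpa using (hcomp.clm_apply (hasDerivAt_const t (y - x))).deriv

namespace ExponentialFamily

variable {𝒳 : Type u} [MeasurableSpace 𝒳] {ν : Measure 𝒳} {d : ℕ} (E : ExponentialFamily ν d)
  {θ θ₀ θ₁ : EuclideanSpace ℝ (Fin d)} {α : ℝ}

theorem isDensity_pdf (hθ : θ ∈ E.Θ) : IsDensity ν (E.pdf θ) where
  measurable := by
    have hT := E.measurable_T
    have hh := E.measurable_h
    unfold pdf
    fun_prop
  nonneg x := mul_nonneg (E.h_nonneg x) (Real.exp_nonneg _)
  integral_eq_one := E.integral_eq_one θ hθ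

theorem isEquivDensityPair_pdf (h₀ : θ₀ ∈ E.Θ) (h₁ : θ₁ ∈ E.Θ) :
    IsEquivDensityPair ν (E.pdf θ₀) (E.pdf θ₁) where
  left := E.isDensity_pdf h₀
  right := E.isDensity_pdf h₁
  pos_iff := .of_forall fun x => by
    simp only [pdf, mul_pos_iff_of_pos_right (Real.exp_pos _)]

theorem rpow_mul_rpow_pdf (α : ℝ) (x : 𝒳) :
    E.pdf θ₀ x ^ (1 - α) * E.pdf θ₁ x ^ α = E.pdf ((1 - α) • θ₀ + α • θ₁) x *
      Real.exp (E.A ((1 - α) • θ₀ + α • θ₁) - ((1 - α) * E.A θ₀ + α * E.A θ₁)) := by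
  have hh : E.h x ^ (1 - α) * E.h x ^ α = E.h x := by
    rw [← Real.rpow_add' (E.h_nonneg x) (by simp), sub_add_cancel, Real.rpow_one]
  simp only [pdf]
  rw [Real.mul_rpow (E.h_nonneg x) (Real.exp_nonneg _),
    Real.mul_rpow (E.h_nonneg x) (Real.exp_nonneg _), mul_mul_mul_comm, hh, ← Real.exp_mul,
    ← Real.exp_mul, ← Real.exp_add, mul_assoc, ← Real.exp_add, inner_add_left,
    real_inner_smul_left, real_inner_smul_left]
  ring_nf

theorem chernoffDiv_pdf (h₀ : θ₀ ∈ E.Θ) (h₁ : θ₁ ∈ E.Θ) (hα : α ∈ Set.Icc (0 : ℝ) 1) :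
    chernoffDiv ν (E.pdf θ₀) (E.pdf θ₁) α =
      (1 - α) * E.A θ₀ + α * E.A θ₁ - E.A ((1 - α) • θ₀ + α • θ₁) := by
  have hmem : (1 - α) • θ₀ + α • θ₁ ∈ E.Θ :=
    E.convex_Θ h₀ h₁ (sub_nonneg.2 hα.2) hα.1 (sub_add_cancel 1 α)
  simp only [chernoffDiv, E.rpow_mul_rpow_pdf]
  rw [integral_mul_const, (E.isDensity_pdf hmem).integral_eq_one, one_mul, Real.log_exp, neg_sub]

theorem varZ_pdf (h₀ : θ₀ ∈ E.Θ) (h₁ : θ₁ ∈ E.Θ) (hα : α ∈ Set.Ioo (0 : ℝ) 1) :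
    varZ ν (E.pdf θ₀) (E.pdf θ₁) α =
      hessianForm E.A ((1 - α) • θ₀ + α • θ₁) (θ₀ - θ₁) := by
  have hmem : AffineMap.lineMap θ₀ θ₁ α ∈ E.Θ :=
    E.convex_Θ.lineMap_mem h₀ h₁ (Set.Ioo_subset_Icc_self hα)
  have hA : ContDiffAt ℝ 2 E.A (AffineMap.lineMap θ₀ θ₁ α) :=
    (E.smooth_A _ hmem).of_le (WithTop.coe_le_coe.2 le_top)
  have hdiv : chernoffDiv ν (E.pdf θ₀) (E.pdf θ₁) =ᶠ[nhds α] fun β =>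
      AffineMap.lineMap (E.A θ₀) (E.A θ₁) β - E.A (AffineMap.lineMap θ₀ θ₁ β) := by
    filter_upwards [Ioo_mem_nhds hα.1 hα.2] with β hβ
    rw [E.chernoffDiv_pdf h₀ h₁ (Set.Ioo_subset_Icc_self hβ), AffineMap.lineMap_apply_module,
      AffineMap.lineMap_apply_module, smul_eq_mul, smul_eq_mul]
  have hlinear : iteratedDeriv 2 (fun β : ℝ => AffineMap.lineMap (E.A θ₀) (E.A θ₁) β) α = 0 := by
    have hderiv : deriv (fun β : ℝ => AffineMap.lineMap (E.A θ₀) (E.A θ₁) β) =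
        fun _ => E.A θ₁ - E.A θ₀ := funext fun _ => AffineMap.hasDerivAt_lineMap.deriv
    rw [iteratedDeriv_succ, iteratedDeriv_one, hderiv, deriv_const]
  have hcomp : ContDiffAt ℝ 2 (fun β : ℝ => E.A (AffineMap.lineMap θ₀ θ₁ β)) α :=
    hA.comp α (AffineMap.contDiff_lineMap _ _).contDiffAt
  rw [(E.isEquivDensityPair_pdf h₀ h₁).varZ_eq_neg_iteratedDeriv hα, hdiv.iteratedDeriv_eq,
    iteratedDeriv_fun_sub (AffineMap.contDiff_lineMap _ _).contDiffAt hcomp, hlinear,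
    iteratedDeriv_two_comp_lineMap hA, hessianForm_eq_fderiv_fderiv, zero_sub, neg_neg,
    ← AffineMap.lineMap_apply_module, ← neg_sub θ₁ θ₀]
  simp only [map_neg, _root_.neg_apply, neg_neg]

theorem chernoffDiv_prodDensity_pdf {n : ℕ} {Ω : Fin n → Type u} [∀ j, MeasurableSpace (Ω j)]
    {μ : ∀ j, Measure (Ω j)} [∀ j, SigmaFinite (μ j)] (E : ∀ j, ExponentialFamily (μ j) d)
    {θ₀ θ₁ : Fin n → EuclideanSpace ℝ (Fin d)} (hθ : ∀ j, θ₀ j ∈ (E j).Θ ∧ θ₁ j ∈ (E j).Θ)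
    (hα : α ∈ Set.Icc (0 : ℝ) 1) :
    chernoffDiv (Measure.pi μ) (prodDensity fun j => (E j).pdf (θ₀ j))
      (prodDensity fun j => (E j).pdf (θ₁ j)) α =
      ∑ j, ((1 - α) * (E j).A (θ₀ j) + α * (E j).A (θ₁ j)
        - (E j).A ((1 - α) • θ₀ j + α • θ₁ j)) := by
  rw [chernoffDiv_prodDensity (fun j => (E j).isEquivDensityPair_pdf (hθ j).1 (hθ j).2) hα]
  exact Finset.sum_congr rfl fun j _ => (E j).chernoffDiv_pdf (hθ j).1 (hθ j).2 hα

end ExponentialFamily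

end ExponentialFamilies

theorem mainTheorem3_general (C₁ : ℝ) :
    ∃ C₂ C₃ C₄ : ℝ, 0 < C₂ ∧ 0 < C₃ ∧ 0 < C₄ ∧
      ∀ (n : ℕ) (Ω : Fin n → Type u) [∀ j, MeasurableSpace (Ω j)]
        (μ : ∀ j, Measure (Ω j)) [∀ j, SigmaFinite (μ j)] (φ₀ φ₁ : ∀ j, Ω j → ℝ),
        (∀ j, IsEquivDensityPair (μ j) (φ₀ j) (φ₁ j)) →
        ¬ prodDensity φ₀ =ᵐ[Measure.pi μ] prodDensity φ₁ →
        (∃! α : ℝ, IsChernoffPoint (Measure.pi μ) (prodDensity φ₀) (prodDensity φ₁) α) ∧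
        ∀ α : ℝ, IsChernoffPoint (Measure.pi μ) (prodDensity φ₀) (prodDensity φ₁) α →
          0 < sigmaBar μ φ₀ φ₁ α ∧
          (∑ j, absThirdMomentZ (μ j) (φ₀ j) (φ₁ j) α ≤ C₁ * n * sigmaBar μ φ₀ φ₁ α ^ 2 →
            expectG (Measure.pi μ) (prodDensity φ₀) (prodDensity φ₁) α ≤
              C₂ / (√n * sigmaBar μ φ₀ φ₁ α * (1 - α) * α) ∧
            affinity (Measure.pi μ) (prodDensity φ₀) (prodDensity φ₁) ≤
              C₂ / (√n * sigmaBar μ φ₀ φ₁ α * (1 - α) * α) *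
                Real.exp (-chernoffDiv (Measure.pi μ) (prodDensity φ₀) (prodDensity φ₁) α) ∧
            (C₃ ≤ √n * sigmaBar μ φ₀ φ₁ α * (1 - α) * α →
              C₄ / (√n * sigmaBar μ φ₀ φ₁ α * (1 - α) * α) ≤
                expectG (Measure.pi μ) (prodDensity φ₀) (prodDensity φ₁) α ∧
              C₄ / (√n * sigmaBar μ φ₀ φ₁ α * (1 - α) * α) *
                  Real.exp (-chernoffDiv (Measure.pi μ) (prodDensity φ₀) (prodDensity φ₁) α) ≤
                affinity (Measure.pi μ) (prodDensity φ₀) (prodDensity φ₁))) ∧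
          ∀ (d : ℕ) (E : ∀ j, ExponentialFamily (μ j) d)
            (θ₀ θ₁ : Fin n → EuclideanSpace ℝ (Fin d)),
            (∀ j, θ₀ j ∈ (E j).Θ ∧ θ₁ j ∈ (E j).Θ) →
            (∀ j, φ₀ j = (E j).pdf (θ₀ j) ∧ φ₁ j = (E j).pdf (θ₁ j)) →
            (∀ j, varZ (μ j) (φ₀ j) (φ₁ j) α =
              hessianForm (E j).A ((1 - α) • θ₀ j + α • θ₁ j) (θ₀ j - θ₁ j)) ∧
            sigmaBar μ φ₀ φ₁ α ^ 2 =
              (1 / (n : ℝ)) *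
                ∑ j, hessianForm (E j).A ((1 - α) • θ₀ j + α • θ₁ j) (θ₀ j - θ₁ j) ∧
            chernoffDiv (Measure.pi μ) (prodDensity φ₀) (prodDensity φ₁) α =
              ∑ j, ((1 - α) * (E j).A (θ₀ j) + α * (E j).A (θ₁ j)
                - (E j).A ((1 - α) • θ₀ j + α • θ₁ j)) ∧
            (∑ j, absThirdMomentZ (μ j) (φ₀ j) (φ₁ j) α ≤ C₁ * n * sigmaBar μ φ₀ φ₁ α ^ 2 →
              affinity (Measure.pi μ) (prodDensity φ₀) (prodDensity φ₁) ≤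
                C₂ / (√n * sigmaBar μ φ₀ φ₁ α * (1 - α) * α) *
                  Real.exp (-∑ j, ((1 - α) * (E j).A (θ₀ j) + α * (E j).A (θ₁ j)
                    - (E j).A ((1 - α) • θ₀ j + α • θ₁ j))) ∧
              (C₃ ≤ √n * sigmaBar μ φ₀ φ₁ α * (1 - α) * α →
                C₄ / (√n * sigmaBar μ φ₀ φ₁ α * (1 - α) * α) *
                    Real.exp (-∑ j, ((1 - α) * (E j).A (θ₀ j) + α * (E j).A (θ₁ j)
                      - (E j).A ((1 - α) • θ₀ j + α • θ₁ j))) ≤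
                  affinity (Measure.pi μ) (prodDensity φ₀) (prodDensity φ₁))) := by
  set K := max C₁ 1
  set M := 163840 * K ^ 5 with hM
  have hK1 : 1 ≤ K := le_max_right _ _
  refine ⟨10 * K ^ 2, 1536 * K ^ 2 * M, Real.exp (-(8 * M)) * (M / (1024 * K ^ 2)), by positivity,
    by positivity, by positivity, fun n Ω _ μ _ φ₀ φ₁ h hne => ?_⟩
  have hprod := isEquivDensityPair_prodDensity h
  refine ⟨hprod.existsUnique_isChernoffPoint hne, fun α hα => ?_⟩
  have hα' := Set.Ioo_subset_Icc_self hα.1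
  have hmono : C₁ * n * sigmaBar μ φ₀ φ₁ α ^ 2 ≤ K * n * sigmaBar μ φ₀ φ₁ α ^ 2 := by
    gcongr
    exact le_max_left _ _
  have hupper := fun h3 => expectG_prodDensity_le h hα hne hK1 (le_trans h3 hmono)
  have hlower := fun h3 => le_expectG_prodDensity h hα hK1 hM.ge (le_trans h3 hmono)
  simp only [hprod.affinity_le_mul_exp_iff hα', hprod.mul_exp_le_affinity_iff hα']
  refine ⟨sigmaBar_pos h hα.1 hne, fun h3 => ⟨hupper h3, hupper h3,
    fun hσ => ⟨hlower h3 hσ, hlower h3 hσ⟩⟩, fun d E θ₀ θ₁ hθ hφ => ?_⟩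
  obtain rfl : φ₀ = fun j => (E j).pdf (θ₀ j) := funext fun j => (hφ j).1
  obtain rfl : φ₁ = fun j => (E j).pdf (θ₁ j) := funext fun j => (hφ j).2
  have hvar := fun j => (E j).varZ_pdf (hθ j).1 (hθ j).2 hα.1
  have hdiv := ExponentialFamily.chernoffDiv_prodDensity_pdf E hθ hα'
  refine ⟨hvar, by rw [sigmaBar_sq, Finset.sum_congr rfl fun j _ => hvar j], hdiv, fun h3 => ?_⟩
  rw [← hdiv, hprod.affinity_le_mul_exp_iff hα', hprod.mul_exp_le_affinity_iff hα']
  exact ⟨hupper h3, hlower h3⟩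

theorem mainTheorem3 (C₁ : ℝ) :
    ∃ C₂ C₃ C₄ : ℝ, 0 < C₂ ∧ 0 < C₃ ∧ 0 < C₄ ∧
      ∀ (n : ℕ) (Ω : Fin n → Type u) [∀ j, MeasurableSpace (Ω j)]
        (μ : ∀ j, Measure (Ω j)) [∀ j, SigmaFinite (μ j)] (φ₀ φ₁ : ∀ j, Ω j → ℝ),
        IsTestingPair μ φ₀ φ₁ →
        (∃! α : ℝ, IsChernoffPoint (Measure.pi μ) (prodDensity φ₀) (prodDensity φ₁) α) ∧
        ∀ α : ℝ, IsChernoffPoint (Measure.pi μ) (prodDensity φ₀) (prodDensity φ₁) α →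
          0 < sigmaBar μ φ₀ φ₁ α ∧
          -- the bounds for general densities, which are to hold with the same constants
          (∑ j, absThirdMomentZ (μ j) (φ₀ j) (φ₁ j) α ≤ C₁ * n * sigmaBar μ φ₀ φ₁ α ^ 2 →
            expectG (Measure.pi μ) (prodDensity φ₀) (prodDensity φ₁) α ≤
              C₂ / (Real.sqrt n * sigmaBar μ φ₀ φ₁ α * (1 - α) * α) ∧
            affinity (Measure.pi μ) (prodDensity φ₀) (prodDensity φ₁) ≤
              C₂ / (Real.sqrt n * sigmaBar μ φ₀ φ₁ α * (1 - α) * α) *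
                Real.exp (-chernoffDiv (Measure.pi μ) (prodDensity φ₀) (prodDensity φ₁) α) ∧
            (C₃ ≤ Real.sqrt n * sigmaBar μ φ₀ φ₁ α * (1 - α) * α →
              C₄ / (Real.sqrt n * sigmaBar μ φ₀ φ₁ α * (1 - α) * α) ≤
                expectG (Measure.pi μ) (prodDensity φ₀) (prodDensity φ₁) α ∧
              C₄ / (Real.sqrt n * sigmaBar μ φ₀ φ₁ α * (1 - α) * α) *
                  Real.exp (-chernoffDiv (Measure.pi μ) (prodDensity φ₀) (prodDensity φ₁) α) ≤
                affinity (Measure.pi μ) (prodDensity φ₀) (prodDensity φ₁))) ∧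
          -- the case of exponential families
          ∀ (d : ℕ) (E : ∀ j, ExponentialFamily (μ j) d)
            (θ₀ θ₁ : Fin n → EuclideanSpace ℝ (Fin d)),
            (∀ j, θ₀ j ∈ (E j).Θ ∧ θ₁ j ∈ (E j).Θ) →
            (∀ j, φ₀ j = (E j).pdf (θ₀ j) ∧ φ₁ j = (E j).pdf (θ₁ j)) →
            (∀ j, varZ (μ j) (φ₀ j) (φ₁ j) α =
              hessianForm (E j).A ((1 - α) • θ₀ j + α • θ₁ j) (θ₀ j - θ₁ j)) ∧
            sigmaBar μ φ₀ φ₁ α ^ 2 =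
              (1 / (n : ℝ)) *
                ∑ j, hessianForm (E j).A ((1 - α) • θ₀ j + α • θ₁ j) (θ₀ j - θ₁ j) ∧
            chernoffDiv (Measure.pi μ) (prodDensity φ₀) (prodDensity φ₁) α =
              ∑ j, ((1 - α) * (E j).A (θ₀ j) + α * (E j).A (θ₁ j)
                - (E j).A ((1 - α) • θ₀ j + α • θ₁ j)) ∧
            (∑ j, absThirdMomentZ (μ j) (φ₀ j) (φ₁ j) α ≤ C₁ * n * sigmaBar μ φ₀ φ₁ α ^ 2 →
              affinity (Measure.pi μ) (prodDensity φ₀) (prodDensity φ₁) ≤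
                C₂ / (Real.sqrt n * sigmaBar μ φ₀ φ₁ α * (1 - α) * α) *
                  Real.exp (-∑ j, ((1 - α) * (E j).A (θ₀ j) + α * (E j).A (θ₁ j)
                    - (E j).A ((1 - α) • θ₀ j + α • θ₁ j))) ∧
              (C₃ ≤ Real.sqrt n * sigmaBar μ φ₀ φ₁ α * (1 - α) * α →
                C₄ / (Real.sqrt n * sigmaBar μ φ₀ φ₁ α * (1 - α) * α) *
                    Real.exp (-∑ j, ((1 - α) * (E j).A (θ₀ j) + α * (E j).A (θ₁ j)
                      - (E j).A ((1 - α) • θ₀ j + α • θ₁ j))) ≤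
                  affinity (Measure.pi μ) (prodDensity φ₀) (prodDensity φ₁))) := by
  obtain ⟨C₂, C₃, C₄, hC₂, hC₃, hC₄, hbounds⟩ := mainTheorem3_general.{u} C₁
  exact ⟨C₂, C₃, C₄, hC₂, hC₃, hC₄, fun n Ω _ μ _ φ₀ φ₁ h =>
    hbounds n Ω μ φ₀ φ₁ h.isEquivDensityPair h.not_ae_eq⟩
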